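/- Let $d,K_0,K_1\ge 1$. For $i\in\{0,1\}$ let $\mu_i=\sum_{k=1}^{K_i}\pi_i^k\mu_i^k$ be a Gaussian mixture on $\mathbb R^d$, where $\pi_i^k\ge 0$, $\sum_k\pi_i^k=1$, and $\mu_i^k=\mathcal N(m_i^k,\Sigma_i^k)$ with $\Sigma_i^k$ symmetric positive semidefinite (possibly singular; Dirac masses count as Gaussian). Write $GMM_n(K)$ for the set of Gaussian mixtures on $\mathbb R^n$ with at most $K$ components and $GMM_n(\infty)=\bigcup_K GMM_n(K)$. Let $\Pi(\mu,\nu)$ be the set of measures on $\mathbb R^d\times\mathbb R^d$ with marginals $\mu,\nu$, and set $$W_2^2(\mu,\nu)=\inf_{\gamma\in\Pi(\mu,\nu)}\int\|x-y\|^2d\gamma,\qquad MW_2^2(\mu,\nu)=\inf_{\gamma\in\Pi(\mu,\nu)\cap GMM_{2d}(\infty)}\int\|x-y\|^2d\gamma .$$ A plan attaining the first (resp. second) infimum is called $W_2$-optimal (resp. $MW_2$-optimal). Let $P_t(x,y)=(1-t)x+ty$. A displacement interpolation between $\mu$ and $\nu$ is a path $(P_t\#\gamma)_{t\in[0,1]}$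 with $\gamma$ a $W_2$-optimal plan between $\mu$ and $\nu$. A nonnegative $K_0\times K_1$ matrix $w^*$ is called optimal if it minimizes $\sum_{k,l}w_{kl}W_2^2(\mu_0^k,\mu_1^l)$ over all nonnegative matrices $w$ with row sums $\pi_0^k$ and column sums $\pi_1^l$. Then: 1. For every $MW_2$-optimal plan $\gamma^*$ between $\mu_0$ and $\mu_1$, the barycenters $\mu_t=P_t\#\gamma^*$, $t\in[0,1]$, all belong to $GMM_d(\infty)$, and there are an optimal $w^*$ and displacement interpolations $(\mu_t^{kl})_{t\in[0,1]}$ between $\mu_0^k$ and $\mu_1^l$ such that $$\mu_t=\sum_{k,l}w^*_{kl}\,\mu_t^{kl}\qquad\text{for all } t\in[0,1].$$ 2. Conversely, for every optimal $w^*$ there are an $MW_2$-optimal plan $\gamma^*$ and displacement interpolations $(\mu_t^{kl})_t$ between $\mu_0^k$ and $\mu_1^l$, with every $\mu_t^{kl}$ Gaussian, such that $P_t\#\gamma^*=\sum_{k,l}w^*_{kl}\mu_t^{kl}$ for all $t\in[0,1]$. 3. If $\Sigma_0^k$ is nonsingular, let $$T_{kl}(x)=m_1^l+(\Sigma_0^k)^{-1/2}\big((\Sigma_0^k)^{1/2}\Sigma_1^l(\Sigma_0^k)^{1/2}\big)^{1/2}(\Sigma_0^k)^{-1/2}(x-m_0^k).$$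 Then $(\mathrm{Id},T_{kl})\#\mu_0^k$ is a $W_2$-optimal plan between $\mu_0^k$ and $\mu_1^l$, and every displacement interpolation between $\mu_0^k$ and $\mu_1^l$ is given by $\mu_t^{kl}=((1-t)\mathrm{Id}+tT_{kl})\#\mu_0^k$, $t\in[0,1]$. 4. The plan can be chosen so that the barycenters have at most $K_0+K_1-1$ components: there are an optimal $w^*$ with at most $K_0+K_1-1$ nonzero entries, an $MW_2$-optimal plan $\gamma^*\in GMM_{2d}(K_0+K_1-1)$, and displacement interpolations $(\mu_t^{kl})_t$ consisting of Gaussian measures, such that for all $t\in[0,1]$, $P_t\#\gamma^*=\sum_{k,l}w^*_{kl}\mu_t^{kl}\in GMM_d(K_0+K_1-1)$. -/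

import Mathlib

open MeasureTheory ProbabilityTheory Set
open scoped NNReal ENNReal MatrixOrder

noncomputable section

namespace GMMTransport

/-- `ℝ^d` with its Euclidean norm. -/
abbrev Rd (d : ℕ) : Type := EuclideanSpace ℝ (Fin d)

section General

variable {E : Type*} [TopologicalSpace E] [AddCommMonoid E] [Module ℝ E] [MeasurableSpace E]

/-- `μ` is a Gaussian mixture with at most `K` components: weights may vanish, and components may
be degenerate Gaussians (for instance Dirac masses). -/
def IsGMM (K : ℕ) (μ : Measure E) : Prop :=
  ∃ (π : Fin K → ℝ≥0) (ν : Fin K → Measure E),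
    ∑ k, π k = 1 ∧ (∀ k, IsGaussian (ν k)) ∧ μ = ∑ k, π k • ν k

/-- `μ` is a finite Gaussian mixture. -/
def IsFiniteGMM (μ : Measure E) : Prop := ∃ K : ℕ, IsGMM K μ

end General

variable {d : ℕ}

/-- `γ` is a transport plan: a measure on `ℝ^d × ℝ^d` with marginals `μ` and `ν`. -/
def IsPlan (μ ν : Measure (Rd d)) (γ : Measure (Rd d × Rd d)) : Prop :=
  γ.map Prod.fst = μ ∧ γ.map Prod.snd = ν

/-- The quadratic transport cost `∫ ‖x - y‖² dγ(x, y)`. -/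
def cost (γ : Measure (Rd d × Rd d)) : ℝ≥0∞ := ∫⁻ p, ‖p.1 - p.2‖ₑ ^ 2 ∂γ

/-- The squared Wasserstein distance `W₂²`. -/
def W2sq (μ ν : Measure (Rd d)) : ℝ≥0∞ :=
  ⨅ γ : {γ : Measure (Rd d × Rd d) // IsPlan μ ν γ}, cost γ.1

/-- `γ` is an optimal transport plan for `W₂`. -/
def IsW2Optimal (μ ν : Measure (Rd d)) (γ : Measure (Rd d × Rd d)) : Prop :=
  IsPlan μ ν γ ∧ cost γ = W2sq μ ν

/-- The squared mixture Wasserstein distance `MW₂²`: plans are restricted to finite Gaussian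
mixtures on `ℝ^d × ℝ^d`. -/
def MW2sq (μ ν : Measure (Rd d)) : ℝ≥0∞ :=
  ⨅ γ : {γ : Measure (Rd d × Rd d) // IsPlan μ ν γ ∧ IsFiniteGMM γ}, cost γ.1

/-- `γ` is an optimal transport plan for `MW₂`. -/
def IsMW2Optimal (μ ν : Measure (Rd d)) (γ : Measure (Rd d × Rd d)) : Prop :=
  IsPlan μ ν γ ∧ IsFiniteGMM γ ∧ cost γ = MW2sq μ ν

/-- `P_t (x, y) = (1 - t) x + t y`. -/
def P (t : ℝ) (p : Rd d × Rd d) : Rd d := (1 - t) • p.1 + t • p.2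

/-- The path `ρ` on `[0, 1]` is a `W₂` displacement interpolation between `μ` and `ν`. -/
def IsDisplacementInterpolation (μ ν : Measure (Rd d)) (ρ : ℝ → Measure (Rd d)) : Prop :=
  ∃ γ, IsW2Optimal μ ν γ ∧ ∀ t ∈ Icc (0 : ℝ) 1, ρ t = γ.map (P t)

/-- The affine map
`x ↦ m₁ + S₀^{-1/2} (S₀^{1/2} S₁ S₀^{1/2})^{1/2} S₀^{-1/2} (x - m₀)`. -/
def gaussianMap (m₀ : Rd d) (S₀ : Matrix (Fin d) (Fin d) ℝ)
    (m₁ : Rd d) (S₁ : Matrix (Fin d) (Fin d) ℝ) (x : Rd d) : Rd d :=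
  m₁ + Matrix.toEuclideanCLM (𝕜 := ℝ)
    ((CFC.sqrt S₀)⁻¹ * CFC.sqrt (CFC.sqrt S₀ * S₁ * CFC.sqrt S₀) * (CFC.sqrt S₀)⁻¹) (x - m₀)

variable {K₀ K₁ : ℕ}

/-- The matrix `w` of nonnegative weights has marginals `π₀` and `π₁`. -/
def IsWeightPlan (π₀ : Fin K₀ → ℝ≥0) (π₁ : Fin K₁ → ℝ≥0) (w : Fin K₀ → Fin K₁ → ℝ≥0) : Prop :=
  (∀ k, ∑ l, w k l = π₀ k) ∧ ∀ l, ∑ k, w k l = π₁ l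

/-- The discrete cost `∑ w_{kl} W₂²(μ₀^k, μ₁^l)`. -/
def discreteCost (μ₀ : Fin K₀ → Measure (Rd d)) (μ₁ : Fin K₁ → Measure (Rd d))
    (w : Fin K₀ → Fin K₁ → ℝ≥0) : ℝ≥0∞ :=
  ∑ k, ∑ l, (w k l : ℝ≥0∞) * W2sq (μ₀ k) (μ₁ l)

/-- `w` minimizes the discrete cost among the weight matrices with marginals `π₀` and `π₁`. -/
def IsOptimalWeight (π₀ : Fin K₀ → ℝ≥0) (π₁ : Fin K₁ → ℝ≥0)
    (μ₀ : Fin K₀ → Measure (Rd d)) (μ₁ : Fin K₁ → Measure (Rd d))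
    (w : Fin K₀ → Fin K₁ → ℝ≥0) : Prop :=
  IsWeightPlan π₀ π₁ w ∧
    ∀ w', IsWeightPlan π₀ π₁ w' → discreteCost μ₀ μ₁ w ≤ discreteCost μ₀ μ₁ w'

/-- The number of pairs `(k, l)` with `w_{kl} ≠ 0`. -/
def supportCard (w : Fin K₀ → Fin K₁ → ℝ≥0) : ℕ := {p : Fin K₀ × Fin K₁ | w p.1 p.2 ≠ 0}.ncard

end GMMTransport

end

open GMMTransport

/-!
Distinct Gaussian measures, degenerate ones included, are linearly independent: some continuous
linear functional separates finitely many of them, and on the line the moment generating functions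
`exp (m s + v s ^ 2 / 2)` have pairwise different growth at infinity. Comparing marginals, every
Gaussian mixture plan is therefore `∑ w k l • Γ k l` with `Γ k l` a plan between the components.
Conversely, two Gaussians admit a Gaussian optimal plan: the cost of a plan depends only on the
trace of its cross-covariance, and every matrix which is the cross-covariance of some plan is that
of a Gaussian plan. Hence `MW₂²` is the value of the discrete transport problem with costs
`W₂² (μ₀ᵏ, μ₁ˡ)`, whose minimum is attained at a matrix with at most `K₀ + K₁ - 1` nonzero entries
because its `K₀ + K₁` linear constraints are dependent. An affine map with positive semidefinite
linear part is the gradient of a convex function, so its graph carries the only optimal plan.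
-/

namespace GMMTransport

section LinearIndependence

open Filter Asymptotics

theorem linearIndependent_of_isLittleO {ι α : Type*} [LinearOrder ι] {l : Filter α} {f : ι → α → ℝ}
    (hf : ∀ i, ∃ᶠ x in l, f i x ≠ 0) (hlt : ∀ ⦃i j⦄, i < j → f i =o[l] f j) :
    LinearIndependent ℝ f := by
  rw [linearIndependent_iff']
  intro s
  induction s using Finset.induction_on_max with
  | empty => simp
  | insert m s hm ih =>
    intro c hc
    have hms : m ∉ s := fun h => (hm m h).false
    rw [Finset.sum_insert hms] at hc
    have hrest : (∑ i ∈ s, c i • f i) =o[l] f m :=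
      IsLittleO.sum fun i hi => (hlt (hm i hi)).const_smul_left (c i)
    have hcm : c m = 0 := by
      by_contra hne
      refine isLittleO_irrefl (hf m) ((isLittleO_const_mul_left_iff hne).1 ?_)
      exact hrest.neg_left.congr_left fun x => (eq_neg_of_add_eq_zero_left (congrFun hc x)).symm
    rw [hcm, zero_smul, zero_add] at hc
    exact (Finset.forall_mem_insert ..).2 ⟨hcm, ih c hc⟩

theorem linearIndependent_exp_quadratic :
    LinearIndependent ℝ fun (p : ℝ × ℝ) (s : ℝ) => Real.exp (p.1 * s + p.2 * s ^ 2 / 2) := by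
  have hlex : LinearIndependent ℝ fun (p : ℝ ×ₗ ℝ) (s : ℝ) =>
      Real.exp ((ofLex p).2 * s + (ofLex p).1 * s ^ 2 / 2) := by
    refine linearIndependent_of_isLittleO (l := atTop)
      (fun p => .of_forall fun s => Real.exp_ne_zero _) fun p q hpq => ?_
    rw [Real.isLittleO_exp_comp_exp_comp]
    rcases Prod.Lex.lt_iff.1 hpq with h | ⟨h, h'⟩
    · have hlin : Tendsto (fun s : ℝ => ((ofLex q).1 - (ofLex p).1) / 2 * s +
          ((ofLex q).2 - (ofLex p).2)) atTop atTop :=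
        tendsto_atTop_add_const_right _ _ (tendsto_id.const_mul_atTop (by linarith))
      exact (tendsto_id.atTop_mul_atTop₀ hlin).congr fun s => by simp only [id]; ring
    · exact (tendsto_id.const_mul_atTop (sub_pos.2 h')).congr fun s => by simp only [id, h]; ring
  exact hlex.comp (fun p : ℝ × ℝ => toLex p.swap) (toLex.injective.comp Prod.swap_injective)

theorem exists_forall_ne_zero_of_polynomial_on_lines {R V ι : Type*} [CommRing R] [IsDomain R]
    [Infinite R] [AddCommGroup V] [Module R V] (F : Finset ι) (D : ι → V → R)
    (hD : ∀ i v w, ∃ q : Polynomial R, ∀ s : R, D i (v + s • w) = q.eval s)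
    (hne : ∀ i ∈ F, ∃ v, D i v ≠ 0) : ∃ v, ∀ i ∈ F, D i v ≠ 0 := by
  classical
  induction F using Finset.induction_on with
  | empty => simp
  | insert i F _ ih =>
    obtain ⟨v, hv⟩ := ih fun j hj => hne j (Finset.mem_insert_of_mem hj)
    obtain ⟨u, hu⟩ := hne i (Finset.mem_insert_self _ _)
    choose q hq using fun j => hD j v (u - v)
    have hq_ne : ∏ j ∈ insert i F, q j ≠ 0 := by
      refine Finset.prod_ne_zero_iff.2 fun j hj hj0 => ?_
      have hvan : ∀ s, D j (v + s • (u - v)) = 0 := fun s => by rw [hq, hj0, Polynomial.eval_zero]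
      rcases Finset.mem_insert.1 hj with rfl | hj
      · exact hu (by simpa using hvan 1)
      · exact hv j hj (by simpa using hvan 0)
    obtain ⟨s, hs⟩ : ∃ s, (∏ j ∈ insert i F, q j).eval s ≠ 0 := by
      by_contra! h
      exact hq_ne (Polynomial.funext (by simpa using h))
    rw [Polynomial.eval_prod, Finset.prod_ne_zero_iff] at hs
    exact ⟨v + s • (u - v), fun j hj => hq j s ▸ hs j hj⟩

theorem linearIndependent_gaussianReal :
    LinearIndependent ℝ≥0 fun p : ℝ × ℝ≥0 => gaussianReal p.1 p.2 := by
  have hexp : LinearIndependent ℝ fun (p : ℝ × ℝ≥0) (s : ℝ) =>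
      Real.exp (p.1 * s + p.2 * s ^ 2 / 2) :=
    linearIndependent_exp_quadratic.comp (fun p : ℝ × ℝ≥0 => (p.1, (p.2 : ℝ)))
      (Function.injective_id.prodMap NNReal.coe_injective)
  rw [linearIndependent_iff'ₛ] at hexp ⊢
  intro s f g hfg i hi
  have mgf_sum : ∀ (c : ℝ × ℝ≥0 → ℝ≥0) (t : ℝ),
      mgf id (∑ p ∈ s, c p • gaussianReal p.1 p.2) t =
        ∑ p ∈ s, (c p : ℝ) * Real.exp (p.1 * t + p.2 * t ^ 2 / 2) := by
    intro c t
    rw [mgf, integral_finsetSum_measure (f := fun x => Real.exp (t * id x)) fun p _ =>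
      (integrable_exp_mul_gaussianReal t).smul_measure_nnreal]
    refine Finset.sum_congr rfl fun p _ => ?_
    rw [integral_smul_nnreal_measure, ← mgf, mgf_id_gaussianReal]
    rfl
  refine NNReal.coe_injective (hexp s (fun p => f p) (fun p => g p) (funext fun t => ?_) i hi)
  simpa [mgf_sum] using congrArg (mgf id · t) hfg

end LinearIndependence

section Gaussian

theorem map_sum_smul {ι α β : Type*} [MeasurableSpace α] [MeasurableSpace β] (s : Finset ι)
    (c : ι → ℝ≥0) (μ : ι → Measure α) {f : α → β} (hf : Measurable f) :
    (∑ i ∈ s, c i • μ i).map f = ∑ i ∈ s, c i • (μ i).map f := by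
  rw [Measure.map_finset_sum hf.aemeasurable]
  simp only [Measure.map_smul]

theorem exists_polynomial_mean_variance_on_line {E : Type*} [NormedAddCommGroup E]
    [NormedSpace ℝ E] [MeasurableSpace E] [BorelSpace E] (μ : Measure E) [IsGaussian μ]
    (L M : StrongDual ℝ E) : ∃ p q : Polynomial ℝ, ∀ s : ℝ,
      μ[L + s • M] = p.eval s ∧ Var[L + s • M; μ] = q.eval s := by
  have hL : MemLp L 2 μ := IsGaussian.memLp_dual μ L 2 (by simp)
  have hM : MemLp M 2 μ := IsGaussian.memLp_dual μ M 2 (by simp)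
  refine ⟨.C μ[L] + .C μ[M] * .X,
    .C Var[L; μ] + .C (2 * cov[L, M; μ]) * .X + .C Var[M; μ] * .X ^ 2,
    fun s => ⟨?_, ?_⟩⟩
  · simp only [add_apply, smul_apply, smul_eq_mul]
    rw [integral_add (hL.integrable one_le_two) ((hM.integrable one_le_two).const_mul s),
      integral_const_mul]
    simp only [Polynomial.eval_add, Polynomial.eval_mul, Polynomial.eval_C, Polynomial.eval_X]
    ring
  · rw [FunLike.coe_add, FunLike.coe_smul, variance_add hL (hM.const_smul s),
      covariance_smul_right, variance_smul]
    simp only [Polynomial.eval_add, Polynomial.eval_mul, Polynomial.eval_C, Polynomial.eval_X,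
      Polynomial.eval_pow]
    ring

variable {E : Type*} [NormedAddCommGroup E] [NormedSpace ℝ E] [CompleteSpace E]
  [SecondCountableTopology E] [MeasurableSpace E] [BorelSpace E]

theorem exists_injOn_map_dual (F : Finset {μ : Measure E // IsGaussian μ}) :
    ∃ L : StrongDual ℝ E, InjOn (fun μ : {μ : Measure E // IsGaussian μ} => μ.1.map L) F := by
  classical
  have := fun μ : {μ : Measure E // IsGaussian μ} => μ.2
  have eq_of_mean_variance {μ ν : {μ : Measure E // IsGaussian μ}} {L : StrongDual ℝ E} :
      ((μ.1)[L] - (ν.1)[L]) ^ 2 + (Var[L; μ.1] - Var[L; ν.1]) ^ 2 = 0 ↔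
        μ.1.map L = ν.1.map L := by
    rw [IsGaussian.map_eq_gaussianReal, IsGaussian.map_eq_gaussianReal, gaussianReal_ext_iff,
      Real.toNNReal_eq_toNNReal_iff (variance_nonneg _ _) (variance_nonneg _ _),
      add_eq_zero_iff_of_nonneg (sq_nonneg _) (sq_nonneg _), sq_eq_zero_iff, sq_eq_zero_iff,
      sub_eq_zero, sub_eq_zero]
  obtain ⟨L, hL⟩ := exists_forall_ne_zero_of_polynomial_on_lines F.offDiag
    (fun p (L : StrongDual ℝ E) => ((p.1.1)[L] - (p.2.1)[L]) ^ 2 +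
      (Var[L; p.1.1] - Var[L; p.2.1]) ^ 2)
    (fun p L M => by
      obtain ⟨m₁, v₁, h₁⟩ := exists_polynomial_mean_variance_on_line p.1.1 L M
      obtain ⟨m₂, v₂, h₂⟩ := exists_polynomial_mean_variance_on_line p.2.1 L M
      exact ⟨(m₁ - m₂) ^ 2 + (v₁ - v₂) ^ 2, fun s => by
        simp [← (h₁ s).1, ← (h₁ s).2, ← (h₂ s).1, ← (h₂ s).2]⟩)
    (fun p hp => by
      by_contra! h
      refine (Finset.mem_offDiag.1 hp).2.2 (Subtype.ext (Measure.ext_of_charFunDual ?_))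
      funext L
      rw [charFunDual_eq_charFun_map_one, charFunDual_eq_charFun_map_one,
        eq_of_mean_variance.1 (h L)])
  refine ⟨L, fun μ hμ ν hν hμν => ?_⟩
  by_contra hne
  exact hL (μ, ν) (Finset.mem_offDiag.2 ⟨hμ, hν, hne⟩) (eq_of_mean_variance.2 hμν)

theorem linearIndependent_isGaussian :
    LinearIndependent ℝ≥0 (Subtype.val : {μ : Measure E // IsGaussian μ} → Measure E) := by
  rw [linearIndependent_iff'ₛ]
  intro F f g hfg
  obtain ⟨L, hL⟩ := exists_injOn_map_dual F
  have hmap (μ : {μ : Measure E // IsGaussian μ}) :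
      μ.1.map L = gaussianReal (μ.1)[L] (Var[L; μ.1]).toNNReal :=
    have := μ.2; IsGaussian.map_eq_gaussianReal L
  have hmap_sum (c : {μ : Measure E // IsGaussian μ} → ℝ≥0) :
      (∑ μ ∈ F, c μ • μ.1).map L =
        ∑ μ ∈ F, c μ • gaussianReal (μ.1)[L] (Var[L; μ.1]).toNNReal := by
    simp only [map_sum_smul _ _ _ L.measurable, hmap]
  have hindep : LinearIndepOn ℝ≥0 (fun μ : {μ : Measure E // IsGaussian μ} =>
      gaussianReal (μ.1)[L] (Var[L; μ.1]).toNNReal) F :=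
    linearIndependent_gaussianReal.comp (fun μ : F => ((μ.1.1)[L], (Var[L; μ.1.1]).toNNReal))
      fun μ ν h => Subtype.ext (hL μ.2 ν.2 (by
        obtain ⟨hm, hv⟩ := Prod.ext_iff.1 h
        simp only [hmap]
        exact congrArg₂ gaussianReal hm hv))
  refine linearIndepOn_finset_iffₛ.1 hindep f g ?_
  rw [← hmap_sum, ← hmap_sum, hfg]

end Gaussian

section Coupling

variable {J K L : Type*} [Fintype J] [Fintype K]

theorem sum_fiber_eq_of_linearIndependent {ι R M : Type*} [Semiring R] [AddCommMonoid M]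
    [Module R M] [DecidableEq ι] {v : ι → M} (hv : LinearIndependent R v) {a : J → R} {α : J → ι}
    {b : K → R} {β : K → ι} (h : ∑ j, a j • v (α j) = ∑ k, b k • v (β k)) (i : ι) :
    ∑ j with α j = i, a j = ∑ k with β k = i, b k := by
  have hsingle : ∑ j, Finsupp.single (α j) (a j) = ∑ k, Finsupp.single (β k) (b k) :=
    hv (by simpa only [map_sum, Finsupp.linearCombination_single] using h)
  simpa only [Finsupp.finsetSum_apply, Finsupp.single_apply, ← Finset.sum_filter] using
    DFunLike.congr_fun hsingle i

theorem exists_coupling_of_sum_fiber_eq [DecidableEq L] {a : J → ℝ≥0} {α : J → L} {b : K → ℝ≥0}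
    {β : K → L} (h : ∀ x, ∑ j with α j = x, a j = ∑ k with β k = x, b k) :
    ∃ q : J → K → ℝ≥0, (∀ j, ∑ k, q j k = a j) ∧ (∀ k, ∑ j, q j k = b k) ∧
      ∀ j k, q j k ≠ 0 → α j = β k := by
  refine ⟨fun j k => if α j = β k then a j * b k / ∑ i with β i = β k, b i else 0,
    fun j => ?_, fun k => ?_, fun j k => by simp +contextual⟩
  · calc ∑ k, (if α j = β k then a j * b k / ∑ i with β i = β k, b i else 0)
        = ∑ k with β k = α j, a j * b k / ∑ i with β i = α j, b i := by
          rw [Finset.sum_filter]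
          refine Finset.sum_congr rfl fun k _ => ?_
          rcases eq_or_ne (α j) (β k) with hk | hk
          · simp only [hk]
          · rw [if_neg hk, if_neg hk.symm]
      _ = a j * (∑ k with β k = α j, b k) / ∑ k with β k = α j, b k := by
          rw [Finset.mul_sum, Finset.sum_div]
      _ = a j := mul_div_cancel_of_imp fun h0 =>
          Finset.sum_eq_zero_iff.1 ((h (α j)).trans h0) j (by simp)
  · calc ∑ j, (if α j = β k then a j * b k / ∑ i with β i = β k, b i else 0)
        = (∑ j with α j = β k, a j) * b k / ∑ i with β i = β k, b i := by
          rw [← Finset.sum_filter, Finset.sum_mul, Finset.sum_div]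
      _ = b k := by
          rw [h (β k)]
          exact mul_div_cancel_left_of_imp fun h0 => Finset.sum_eq_zero_iff.1 h0 k (by simp)

theorem exists_coupling {a : J → ℝ≥0} {b : K → ℝ≥0} (h : ∑ j, a j = ∑ k, b k) :
    ∃ q : J → K → ℝ≥0, (∀ j, ∑ k, q j k = a j) ∧ ∀ k, ∑ j, q j k = b k := by
  obtain ⟨q, hrow, hcol, -⟩ :=
    exists_coupling_of_sum_fiber_eq (α := fun _ => ()) (β := fun _ => ()) (by simpa using h)
  exact ⟨q, hrow, hcol⟩

end Coupling

section Mixture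

/-- The average of the measures `g j` with weights proportional to `c j`; it is `0` when all the
weights vanish. -/
noncomputable def weightedAverage {J α : Type*} [Fintype J] [MeasurableSpace α] (c : J → ℝ≥0)
    (g : J → Measure α) : Measure α :=
  (∑ j, c j)⁻¹ • ∑ j, c j • g j

variable {J α β : Type*} [Fintype J] [MeasurableSpace α] [MeasurableSpace β] {c : J → ℝ≥0}
  {g : J → Measure α}

theorem sum_smul_weightedAverage : (∑ j, c j) • weightedAverage c g = ∑ j, c j • g j := by
  by_cases hc : ∑ j, c j = 0
  · have hzero : ∀ j, c j = 0 := by simpa using hc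
    simp [hzero]
  · rw [weightedAverage, smul_inv_smul₀ hc]

theorem map_weightedAverage_eq {f : α → β} (hf : Measurable f) {ν : Measure β}
    (hc : ∑ j, c j ≠ 0) (hg : ∀ j, c j ≠ 0 → (g j).map f = ν) :
    (weightedAverage c g).map f = ν := by
  have hterm : ∀ j, c j • (g j).map f = c j • ν := fun j => by
    by_cases h : c j = 0
    · rw [h, zero_smul, zero_smul]
    · rw [hg j h]
  rw [weightedAverage, Measure.map_smul, map_sum_smul _ _ _ hf, Finset.sum_congr rfl fun j _ =>
    hterm j, ← Finset.sum_smul, inv_smul_smul₀ hc]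

theorem exists_coupling_of_sum_smul_isGaussian_eq {E J K : Type*} [NormedAddCommGroup E]
    [NormedSpace ℝ E] [CompleteSpace E] [SecondCountableTopology E] [MeasurableSpace E]
    [BorelSpace E] [Fintype J] [Fintype K] {a : J → ℝ≥0} {g : J → Measure E} {b : K → ℝ≥0}
    {ν : K → Measure E} (hg : ∀ j, IsGaussian (g j)) (hν : ∀ k, IsGaussian (ν k))
    (h : ∑ j, a j • g j = ∑ k, b k • ν k) :
    ∃ q : J → K → ℝ≥0, (∀ j, ∑ k, q j k = a j) ∧ (∀ k, ∑ j, q j k = b k) ∧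
      ∀ j k, q j k ≠ 0 → g j = ν k := by
  classical
  obtain ⟨q, hrow, hcol, hq⟩ := exists_coupling_of_sum_fiber_eq
    (sum_fiber_eq_of_linearIndependent linearIndependent_isGaussian
      (α := fun j => ⟨g j, hg j⟩) (β := fun k => ⟨ν k, hν k⟩) h)
  exact ⟨q, hrow, hcol, fun j k hjk => congrArg Subtype.val (hq j k hjk)⟩

variable {d K₀ K₁ : ℕ} {π₀ : Fin K₀ → ℝ≥0} {π₁ : Fin K₁ → ℝ≥0}
  {ν₀ : Fin K₀ → Measure (Rd d)} {ν₁ : Fin K₁ → Measure (Rd d)}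

theorem exists_plan_decomposition (hν₀ : ∀ k, IsGaussian (ν₀ k)) (hν₁ : ∀ l, IsGaussian (ν₁ l))
    {γ : Measure (Rd d × Rd d)} (hγ : IsPlan (∑ k, π₀ k • ν₀ k) (∑ l, π₁ l • ν₁ l) γ)
    (hG : IsFiniteGMM γ) :
    ∃ w, IsWeightPlan π₀ π₁ w ∧ ∃ Γ : Fin K₀ → Fin K₁ → Measure (Rd d × Rd d),
      (∀ k l, w k l ≠ 0 → IsPlan (ν₀ k) (ν₁ l) (Γ k l)) ∧ γ = ∑ k, ∑ l, w k l • Γ k l := by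
  obtain ⟨J, a, g, -, hg, rfl⟩ := hG
  have hfst : ∀ j, IsGaussian ((g j).map Prod.fst) := fun j =>
    have := hg j; isGaussian_map (.fst ℝ (Rd d) (Rd d))
  have hsnd : ∀ j, IsGaussian ((g j).map Prod.snd) := fun j =>
    have := hg j; isGaussian_map (.snd ℝ (Rd d) (Rd d))
  obtain ⟨q, hq_row, hq_col, hq⟩ := exists_coupling_of_sum_smul_isGaussian_eq hfst hν₀
    ((map_sum_smul _ _ _ measurable_fst).symm.trans hγ.1)
  obtain ⟨r, hr_row, hr_col, hr⟩ := exists_coupling_of_sum_smul_isGaussian_eq hsnd hν₁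
    ((map_sum_smul _ _ _ measurable_snd).symm.trans hγ.2)
  choose c hcq hcr using fun j => exists_coupling ((hq_row j).trans (hr_row j).symm)
  have hqne : ∀ {j k l}, c j k l ≠ 0 → q j k ≠ 0 := fun {j k l} h h0 =>
    h (Finset.sum_eq_zero_iff.1 ((hcq j k).trans h0) l (Finset.mem_univ l))
  have hrne : ∀ {j k l}, c j k l ≠ 0 → r j l ≠ 0 := fun {j k l} h h0 =>
    h (Finset.sum_eq_zero_iff.1 ((hcr j l).trans h0) k (Finset.mem_univ k))
  refine ⟨fun k l => ∑ j, c j k l, ⟨fun k => ?_, fun l => ?_⟩,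
    fun k l => weightedAverage (c · k l) g, fun k l hkl => ⟨?_, ?_⟩, ?_⟩
  · rw [Finset.sum_comm]
    simp only [hcq, hq_col]
  · rw [Finset.sum_comm]
    simp only [hcr, hr_col]
  · exact map_weightedAverage_eq measurable_fst hkl fun j h => hq j k (hqne h)
  · exact map_weightedAverage_eq measurable_snd hkl fun j h => hr j l (hrne h)
  · simp only [sum_smul_weightedAverage]
    rw [Finset.sum_congr rfl fun k _ => Finset.sum_comm, Finset.sum_comm]
    simp only [← Finset.sum_smul, hcq, hq_row]

end Mixture

section IsGMM

theorem isGMM_sum_of_card_le {E ι : Type*} [TopologicalSpace E] [AddCommMonoid E] [Module ℝ E]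
    [MeasurableSpace E] [Fintype ι] {N : ℕ} (hN : Fintype.card ι ≤ N) {w : ι → ℝ≥0}
    (hw : ∑ i, w i = 1) {g : ι → Measure E} (hg : ∀ i, IsGaussian (g i)) :
    IsGMM N (∑ i, w i • g i) := by
  obtain ⟨e⟩ : Nonempty (ι ↪ Fin N) :=
    Function.Embedding.nonempty_of_card_le (by rwa [Fintype.card_fin])
  obtain ⟨i₀, -⟩ : (Finset.univ : Finset ι).Nonempty :=
    Finset.nonempty_of_sum_ne_zero (hw ▸ one_ne_zero)
  have extend_apply_zero : ∀ n, n ∉ range e → Function.extend e w 0 n = 0 := fun n hn => by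
    rw [Function.extend_apply' _ _ _ hn, Pi.zero_apply]
  refine ⟨Function.extend e w 0, Function.extend e g fun _ => g i₀, ?_, fun n => ?_, ?_⟩
  · rw [← hw]
    exact (Fintype.sum_of_injective e e.injective _ _ extend_apply_zero
      fun i => (e.injective.extend_apply ..).symm).symm
  · by_cases hn : n ∈ range e
    · obtain ⟨i, rfl⟩ := hn
      rw [e.injective.extend_apply]
      exact hg i
    · rw [Function.extend_apply' _ _ _ hn]
      exact hg i₀
  · refine Fintype.sum_of_injective e e.injective _ _
      (fun n hn => by rw [extend_apply_zero n hn, zero_smul]) fun i => ?_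
    simp only [e.injective.extend_apply]

theorem sum_subtype_eq_sum {ι M : Type*} [Fintype ι] [AddCommMonoid M] {p : ι → Prop}
    [DecidablePred p] {F : ι → M} (hF : ∀ i, ¬ p i → F i = 0) :
    ∑ i : {i // p i}, F i = ∑ i, F i :=
  Fintype.sum_of_injective Subtype.val Subtype.val_injective _ _
    (fun i hi => hF i (by simpa using hi)) fun _ => rfl

theorem isGMM_ncard_support_sum {E ι : Type*} [TopologicalSpace E] [AddCommMonoid E]
    [Module ℝ E] [MeasurableSpace E] [Fintype ι] {w : ι → ℝ≥0} (hw : ∑ i, w i = 1)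
    {g : ι → Measure E} (hg : ∀ i, IsGaussian (g i)) :
    IsGMM {i | w i ≠ 0}.ncard (∑ i, w i • g i) := by
  classical
  rw [← sum_subtype_eq_sum fun i (hi : ¬ w i ≠ 0) => by rw [not_not.1 hi, zero_smul]]
  refine isGMM_sum_of_card_le ?_
    ((sum_subtype_eq_sum fun i (hi : ¬ w i ≠ 0) => not_not.1 hi).trans hw) fun i => hg i
  exact Nat.card_eq_fintype_card.ge

theorem IsGMM.mono {E : Type*} [TopologicalSpace E] [AddCommMonoid E] [Module ℝ E]
    [MeasurableSpace E] {K N : ℕ} {μ : Measure E} (h : IsGMM K μ) (hKN : K ≤ N) : IsGMM N μ := by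
  obtain ⟨π, ν, hπ, hν, rfl⟩ := h
  exact isGMM_sum_of_card_le (by rwa [Fintype.card_fin]) hπ hν

theorem IsGMM.map {E F : Type*} [NormedAddCommGroup E] [NormedSpace ℝ E] [MeasurableSpace E]
    [BorelSpace E] [NormedAddCommGroup F] [NormedSpace ℝ F] [MeasurableSpace F] [BorelSpace F]
    {K : ℕ} {μ : Measure E} (h : IsGMM K μ) (L : E →L[ℝ] F) : IsGMM K (μ.map L) := by
  obtain ⟨π, ν, hπ, hν, rfl⟩ := h
  exact ⟨π, fun k => (ν k).map L, hπ, fun k => have := hν k; isGaussian_map L,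
    map_sum_smul _ _ _ L.measurable⟩

end IsGMM

section Covariance

variable {ι : Type*} [Fintype ι]

/-- The covariance matrix of the coordinates under a measure on `ℝ^ι`. -/
noncomputable def covMatrix (μ : Measure (EuclideanSpace ℝ ι)) : Matrix ι ι ℝ :=
  .of fun i j => cov[fun x => x i, fun x => x j; μ]

theorem posSemidef_covMatrix {μ : Measure (EuclideanSpace ℝ ι)} [IsProbabilityMeasure μ]
    (hμ : MemLp id 2 μ) : (covMatrix μ).PosSemidef := by
  have hcoord : ∀ i, MemLp (fun x : EuclideanSpace ℝ ι => x i) 2 μ := fun i =>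
    (EuclideanSpace.proj (𝕜 := ℝ) i).comp_memLp' hμ
  refine .of_dotProduct_mulVec_nonneg ?_ fun a => ?_
  · ext i j
    exact covariance_comm ..
  · have hvar : Var[∑ i, a i • fun x : EuclideanSpace ℝ ι => x i; μ] =
        star a ⬝ᵥ (covMatrix μ).mulVec a := by
      rw [← covariance_self (Finset.aemeasurable_sum _ fun i _ =>
          ((hcoord i).const_smul _).aemeasurable),
        covariance_sum_sum (fun i => (hcoord i).const_smul _) fun i => (hcoord i).const_smul _]
      simp only [covariance_smul_left, covariance_smul_right, dotProduct, Matrix.mulVec,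
        covMatrix, Matrix.of_apply, Finset.mul_sum, star_trivial]
      exact Finset.sum_congr rfl fun i _ => Finset.sum_congr rfl fun j _ => by ring
    exact hvar ▸ variance_nonneg _ _

theorem covMatrix_multivariateGaussian [DecidableEq ι] (m : EuclideanSpace ℝ ι) {S : Matrix ι ι ℝ}
    (hS : S.PosSemidef) : covMatrix (multivariateGaussian m S) = S := by
  ext i j
  exact covariance_eval_multivariateGaussian hS i j

theorem eq_of_integral_eq_of_covMatrix_eq {μ ν : Measure (EuclideanSpace ℝ ι)} [IsGaussian μ]
    [IsGaussian ν] (hm : μ[id] = ν[id]) (hS : covMatrix μ = covMatrix ν) : μ = ν := by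
  refine IsGaussian.ext hm ((ContinuousLinearMap.toBilinForm_inj _ _).1 ?_)
  refine LinearMap.BilinForm.ext_basis (EuclideanSpace.basisFun ι ℝ).toBasis fun i j => ?_
  simpa [covarianceBilin_apply_eq_cov IsGaussian.memLp_two_id, covMatrix] using
    congrFun (congrFun hS i) j

end Covariance

section PosSemidef

variable {ι κ : Type*} [Finite ι] [Finite κ]

theorem abs_apply_le_of_posSemidef {M : Matrix ι ι ℝ} (hM : M.PosSemidef) (i j : ι) :
    |M i j| ≤ (M i i + M j j) / 2 := by
  classical
  cases nonempty_fintype ι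
  have hsymm : M j i = M i j := by simpa only [star_trivial] using hM.isHermitian.apply i j
  have hplus : 0 ≤ M i i + M j j + 2 * M i j := by
    have := hM.dotProduct_mulVec_nonneg (Pi.single i 1 + Pi.single j 1)
    simp only [star_trivial, Matrix.mulVec_add, Matrix.mulVec_single, MulOpposite.op_one,
      one_smul, dotProduct_add, add_dotProduct, single_dotProduct, Matrix.col_apply, one_mul,
      hsymm] at this
    linarith
  have hminus : 0 ≤ M i i + M j j - 2 * M i j := by
    have := hM.dotProduct_mulVec_nonneg (Pi.single i 1 - Pi.single j 1)
    simp only [star_trivial, Matrix.mulVec_sub, Matrix.mulVec_single, MulOpposite.op_one,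
      one_smul, dotProduct_sub, sub_dotProduct, single_dotProduct, Matrix.col_apply, one_mul,
      hsymm] at this
    linarith
  exact abs_le.2 ⟨by linarith, by linarith⟩

theorem isClosed_setOf_posSemidef : IsClosed {M : Matrix ι ι ℝ | M.PosSemidef} := by
  cases nonempty_fintype ι
  simp only [Matrix.posSemidef_iff_dotProduct_mulVec, Matrix.IsHermitian, ofPred_and,
    ofPred_forall]
  exact (isClosed_eq (by fun_prop) (by fun_prop)).inter
    (isClosed_iInter fun x => isClosed_le (by fun_prop) (by fun_prop))

theorem isCompact_setOf_posSemidef_fromBlocks (S : Matrix ι ι ℝ) (T : Matrix κ κ ℝ) :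
    IsCompact {C : Matrix ι κ ℝ | (Matrix.fromBlocks S C C.transpose T).PosSemidef} := by
  have hbox : IsCompact (univ.pi fun i => univ.pi fun j =>
      Icc (-((S i i + T j j) / 2)) ((S i i + T j j) / 2) : Set (Matrix ι κ ℝ)) :=
    isCompact_univ_pi fun i => isCompact_univ_pi fun j => isCompact_Icc
  refine hbox.of_isClosed_subset ?_ fun C hC i _ j _ => ?_
  · exact isClosed_setOf_posSemidef.preimage
      (continuous_const.matrix_fromBlocks continuous_id (by fun_prop) continuous_const)
  · exact abs_le.1 (abs_apply_le_of_posSemidef hC (.inl i) (.inr j))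

end PosSemidef

section GaussianPlan

variable {d : ℕ} {μ ν : Measure (Rd d)} {γ : Measure (Rd d × Rd d)}

theorem IsPlan.isProbabilityMeasure [IsProbabilityMeasure μ] (h : IsPlan μ ν γ) :
    IsProbabilityMeasure γ :=
  have : IsProbabilityMeasure (γ.map Prod.fst) := h.1 ▸ inferInstance
  Measure.isProbabilityMeasure_of_map Prod.fst

theorem IsPlan.memLp_fst (h : IsPlan μ ν γ) (hμ : MemLp id 2 μ) : MemLp Prod.fst 2 γ :=
  (memLp_map_measure_iff aestronglyMeasurable_id measurable_fst.aemeasurable).1 (h.1.symm ▸ hμ)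

theorem IsPlan.memLp_snd (h : IsPlan μ ν γ) (hν : MemLp id 2 ν) : MemLp Prod.snd 2 γ :=
  (memLp_map_measure_iff aestronglyMeasurable_id measurable_snd.aemeasurable).1 (h.2.symm ▸ hν)

theorem cost_eq_ofReal_integral (h : Integrable (fun p : Rd d × Rd d => ‖p.1 - p.2‖ ^ 2) γ) :
    cost γ = ENNReal.ofReal (∫ p, ‖p.1 - p.2‖ ^ 2 ∂γ) := by
  rw [cost, ofReal_integral_eq_lintegral_ofReal h (ae_of_all _ fun _ => by positivity)]
  exact lintegral_congr fun p => by rw [ENNReal.ofReal_pow (norm_nonneg _), ofReal_norm]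

theorem integrable_inner_of_memLp_two {Ω E : Type*} [MeasurableSpace Ω] {m : Measure Ω}
    [NormedAddCommGroup E] [InnerProductSpace ℝ E] {f g : Ω → E} (hf : MemLp f 2 m)
    (hg : MemLp g 2 m) : Integrable (fun x => inner ℝ (f x) (g x)) m :=
  memLp_one_iff_integrable.1 (hf.of_bilin (inner ℝ) 1 hg (hf.1.inner hg.1)
    (ae_of_all _ fun x => by simpa using nnnorm_inner_le_nnnorm (f x) (g x)))

/-- The matrix of covariances between the coordinates of the two factors of `ℝ^d × ℝ^d`. -/
noncomputable def crossCov (γ : Measure (Rd d × Rd d)) : Matrix (Fin d) (Fin d) ℝ :=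
  .of fun i j => cov[fun p => p.1 i, fun p => p.2 j; γ]

theorem covMatrix_map_sumEquivProd_symm (γ : Measure (Rd d × Rd d)) :
    covMatrix (γ.map (EuclideanSpace.sumEquivProd (𝕜 := ℝ) (ι := Fin d) (κ := Fin d)).symm) =
      Matrix.fromBlocks (covMatrix (γ.map Prod.fst)) (crossCov γ) (crossCov γ).transpose
        (covMatrix (γ.map Prod.snd)) := by
  ext (i | i) (j | j)
  · simp (disch := fun_prop) only [covMatrix, Matrix.of_apply, Matrix.fromBlocks_apply₁₁,
      covariance_map_fun]
    rfl
  · simp (disch := fun_prop) only [covMatrix, crossCov, Matrix.of_apply,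
      Matrix.fromBlocks_apply₁₂, covariance_map_fun]
    rfl
  · simp (disch := fun_prop) only [covMatrix, crossCov, Matrix.of_apply,
      Matrix.fromBlocks_apply₂₁, Matrix.transpose_apply, covariance_map_fun]
    exact covariance_comm ..
  · simp (disch := fun_prop) only [covMatrix, Matrix.of_apply, Matrix.fromBlocks_apply₂₂,
      covariance_map_fun]
    rfl

theorem IsPlan.posSemidef_fromBlocks [IsProbabilityMeasure μ] (h : IsPlan μ ν γ)
    (hμ : MemLp id 2 μ) (hν : MemLp id 2 ν) :
    (Matrix.fromBlocks (covMatrix μ) (crossCov γ) (crossCov γ).transpose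
      (covMatrix ν)).PosSemidef := by
  have := h.isProbabilityMeasure
  let e := EuclideanSpace.sumEquivProd (𝕜 := ℝ) (ι := Fin d) (κ := Fin d)
  have hid : MemLp id 2 γ := memLp_prod_iff.2 ⟨h.memLp_fst hμ, h.memLp_snd hν⟩
  have hmap : MemLp id 2 (γ.map e.symm) :=
    (memLp_map_measure_iff aestronglyMeasurable_id (by fun_prop)).2
      (e.symm.toContinuousLinearMap.comp_memLp' hid)
  have : IsProbabilityMeasure (γ.map e.symm) :=
    Measure.isProbabilityMeasure_map (by fun_prop)
  rw [← h.1, ← h.2, ← covMatrix_map_sumEquivProd_symm]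
  exact posSemidef_covMatrix hmap

theorem IsPlan.integral_inner [IsProbabilityMeasure μ] (h : IsPlan μ ν γ) (hμ : MemLp id 2 μ)
    (hν : MemLp id 2 ν) :
    ∫ p, inner ℝ p.1 p.2 ∂γ = inner ℝ μ[id] ν[id] + (crossCov γ).trace := by
  have := h.isProbabilityMeasure
  have hfst := h.memLp_fst hμ
  have hsnd := h.memLp_snd hν
  have hfst_coord (i : Fin d) : MemLp (fun p : Rd d × Rd d => p.1 i) 2 γ :=
    (EuclideanSpace.proj (𝕜 := ℝ) i).comp_memLp' hfst
  have hsnd_coord (i : Fin d) : MemLp (fun p : Rd d × Rd d => p.2 i) 2 γ :=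
    (EuclideanSpace.proj (𝕜 := ℝ) i).comp_memLp' hsnd
  have hmean_fst (i : Fin d) : ∫ p, p.1 i ∂γ = μ[id] i := by
    rw [← h.1, integral_map (by fun_prop) (by fun_prop)]
    exact (EuclideanSpace.proj (𝕜 := ℝ) i).integral_comp_comm (hfst.integrable one_le_two)
  have hmean_snd (i : Fin d) : ∫ p, p.2 i ∂γ = ν[id] i := by
    rw [← h.2, integral_map (by fun_prop) (by fun_prop)]
    exact (EuclideanSpace.proj (𝕜 := ℝ) i).integral_comp_comm (hsnd.integrable one_le_two)
  have hcoord (i : Fin d) : ∫ p, p.1 i * p.2 i ∂γ = μ[id] i * ν[id] i + crossCov γ i i := by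
    rw [crossCov, Matrix.of_apply, covariance_eq_sub (hfst_coord i) (hsnd_coord i),
      hmean_fst, hmean_snd, add_sub_cancel]
    rfl
  calc ∫ p, inner ℝ p.1 p.2 ∂γ = ∫ p, ∑ i, p.1 i * p.2 i ∂γ :=
        integral_congr_ae (ae_of_all _ fun p => by
          simp only [PiLp.inner_apply, RCLike.inner_apply', conj_trivial])
    _ = ∑ i, (μ[id] i * ν[id] i + crossCov γ i i) := by
        rw [integral_finsetSum (f := fun i (p : Rd d × Rd d) => p.1 i * p.2 i) _ fun i _ =>
          (hfst_coord i).integrable_mul (hsnd_coord i)]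
        exact Finset.sum_congr rfl fun i _ => hcoord i
    _ = _ := by
        simp only [Finset.sum_add_distrib, PiLp.inner_apply, RCLike.inner_apply', conj_trivial,
          Matrix.trace, Matrix.diag_apply]

theorem IsPlan.cost_eq [IsProbabilityMeasure μ] (h : IsPlan μ ν γ) (hμ : MemLp id 2 μ)
    (hν : MemLp id 2 ν) :
    cost γ = ENNReal.ofReal (∫ x, ‖x‖ ^ 2 ∂μ + ∫ y, ‖y‖ ^ 2 ∂ν -
      2 * (inner ℝ μ[id] ν[id] + (crossCov γ).trace)) := by
  have hfst := h.memLp_fst hμ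
  have hsnd := h.memLp_snd hν
  have hnorm_fst : ∫ p, ‖p.1‖ ^ 2 ∂γ = ∫ x, ‖x‖ ^ 2 ∂μ := by
    rw [← h.1, integral_map (by fun_prop) (by fun_prop)]
  have hnorm_snd : ∫ p, ‖p.2‖ ^ 2 ∂γ = ∫ y, ‖y‖ ^ 2 ∂ν := by
    rw [← h.2, integral_map (by fun_prop) (by fun_prop)]
  rw [cost_eq_ofReal_integral ((hfst.sub hsnd).integrable_norm_pow two_ne_zero)]
  simp only [norm_sub_sq_real]
  have hnorm_fst' : Integrable (fun p => ‖p.1‖ ^ 2) γ := hfst.integrable_norm_pow two_ne_zero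
  have hnorm_snd' : Integrable (fun p => ‖p.2‖ ^ 2) γ := hsnd.integrable_norm_pow two_ne_zero
  have hinner := (integrable_inner_of_memLp_two hfst hsnd).const_mul 2
  rw [integral_add (by exact hnorm_fst'.sub hinner) hnorm_snd', integral_sub hnorm_fst' hinner,
    integral_const_mul, hnorm_fst, hnorm_snd, h.integral_inner hμ hν]
  ring_nf

theorem exists_isGaussian_isPlan [IsGaussian μ] [IsGaussian ν] {C : Matrix (Fin d) (Fin d) ℝ}
    (hC : (Matrix.fromBlocks (covMatrix μ) C C.transpose (covMatrix ν)).PosSemidef) :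
    ∃ g, IsGaussian g ∧ IsPlan μ ν g ∧ crossCov g = C := by
  let e := EuclideanSpace.sumEquivProd (𝕜 := ℝ) (ι := Fin d) (κ := Fin d)
  let G := multivariateGaussian (e.symm (μ[id], ν[id]))
    (Matrix.fromBlocks (covMatrix μ) C C.transpose (covMatrix ν))
  let g := G.map e
  have hG : g.map e.symm = G := by
    rw [Measure.map_map (by fun_prop) (by fun_prop), e.symm_comp_self, Measure.map_id]
  have hblocks := covMatrix_map_sumEquivProd_symm g
  rw [hG, covMatrix_multivariateGaussian _ hC, Matrix.fromBlocks_inj] at hblocks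
  obtain ⟨hfst, hcross, -, hsnd⟩ := hblocks
  have hg_fst : IsGaussian (g.map Prod.fst) :=
    inferInstanceAs (IsGaussian (g.map (ContinuousLinearMap.fst ℝ (Rd d) (Rd d))))
  have hg_snd : IsGaussian (g.map Prod.snd) :=
    inferInstanceAs (IsGaussian (g.map (ContinuousLinearMap.snd ℝ (Rd d) (Rd d))))
  have hmean : g[id] = (μ[id], ν[id]) := by
    rw [integral_map (by fun_prop) (by fun_prop)]
    exact (e.integral_comp_comm id).trans
      ((congrArg e integral_id_multivariateGaussian).trans (e.apply_symm_apply _))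
  have hmean_fst : (g.map Prod.fst)[id] = μ[id] := by
    rw [integral_map (by fun_prop) (by fun_prop)]
    exact (fst_integral IsGaussian.integrable_id).symm.trans (congrArg Prod.fst hmean)
  have hmean_snd : (g.map Prod.snd)[id] = ν[id] := by
    rw [integral_map (by fun_prop) (by fun_prop)]
    exact (snd_integral IsGaussian.integrable_id).symm.trans (congrArg Prod.snd hmean)
  exact ⟨g, inferInstance, ⟨eq_of_integral_eq_of_covMatrix_eq hmean_fst hfst.symm,
    eq_of_integral_eq_of_covMatrix_eq hmean_snd hsnd.symm⟩, hcross.symm⟩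

theorem exists_isGaussian_isW2Optimal (μ ν : Measure (Rd d)) [IsGaussian μ] [IsGaussian ν] :
    ∃ g, IsGaussian g ∧ IsW2Optimal μ ν g := by
  have hprod : IsPlan μ ν (μ.prod ν) := ⟨by simp, by simp⟩
  obtain ⟨C, hC, hmax⟩ := (isCompact_setOf_posSemidef_fromBlocks (covMatrix μ)
    (covMatrix ν)).exists_isMaxOn ⟨_, hprod.posSemidef_fromBlocks
    IsGaussian.memLp_two_id IsGaussian.memLp_two_id⟩
    (f := Matrix.trace) (by fun_prop)
  obtain ⟨g, hg, hplan, rfl⟩ := exists_isGaussian_isPlan hC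
  refine ⟨g, hg, hplan, le_antisymm (le_iInf fun γ => ?_) (iInf_le_of_le ⟨_, hplan⟩ le_rfl)⟩
  rw [hplan.cost_eq IsGaussian.memLp_two_id IsGaussian.memLp_two_id,
    γ.2.cost_eq IsGaussian.memLp_two_id IsGaussian.memLp_two_id]
  gcongr
  exact hmax (γ.2.posSemidef_fromBlocks IsGaussian.memLp_two_id IsGaussian.memLp_two_id)

theorem W2sq_ne_top (μ ν : Measure (Rd d)) [IsGaussian μ] [IsGaussian ν] : W2sq μ ν ≠ ∞ := by
  have hprod : IsPlan μ ν (μ.prod ν) := ⟨by simp, by simp⟩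
  refine ((iInf_le _ ⟨_, hprod⟩).trans_lt ?_).ne
  rw [hprod.cost_eq IsGaussian.memLp_two_id IsGaussian.memLp_two_id]
  exact ENNReal.ofReal_lt_top

end GaussianPlan

section Potentials

variable {d : ℕ} {μ ν : Measure (Rd d)} {γ γ₀ : Measure (Rd d × Rd d)} {φ ψ : Rd d → ℝ}

theorem IsPlan.integrable_potentials (h : IsPlan μ ν γ) (hφ : Integrable φ μ)
    (hψ : Integrable ψ ν) : Integrable (fun p => φ p.1 + ψ p.2) γ := by
  rw [← h.1] at hφ
  rw [← h.2] at hψ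
  exact (hφ.comp_measurable measurable_fst).add (hψ.comp_measurable measurable_snd)

theorem IsPlan.integral_potentials (h : IsPlan μ ν γ) (hφ : Integrable φ μ)
    (hψ : Integrable ψ ν) : ∫ p, φ p.1 + ψ p.2 ∂γ = ∫ x, φ x ∂μ + ∫ y, ψ y ∂ν := by
  rw [← h.1] at hφ ⊢
  rw [← h.2] at hψ ⊢
  rw [integral_map (by fun_prop) hφ.1, integral_map (by fun_prop) hψ.1]
  exact integral_add (hφ.comp_measurable measurable_fst) (hψ.comp_measurable measurable_snd)

theorem isPlan_map_prodMk {T : Rd d → Rd d} (hT : Measurable T) :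
    IsPlan μ (μ.map T) (μ.map fun x => (x, T x)) := by
  constructor <;> rw [Measure.map_map (by fun_prop) (by fun_prop)]
  · exact Measure.map_id
  · rfl

theorem ae_map_prodMk_snd_eq {T : Rd d → Rd d} (hT : Measurable T) :
    ∀ᵐ p ∂μ.map fun x => (x, T x), p.2 = T p.1 :=
  (ae_map_iff (by fun_prop) (measurableSet_eq_fun (by fun_prop) (by fun_prop))).2
    (ae_of_all _ fun _ => rfl)

theorem IsPlan.eq_map_prodMk (h : IsPlan μ ν γ) {T : Rd d → Rd d} (hT : Measurable T)
    (hγT : ∀ᵐ p ∂γ, p.2 = T p.1) : γ = μ.map fun x => (x, T x) := by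
  rw [← h.1, Measure.map_map (by fun_prop) (by fun_prop)]
  nth_rw 1 [← Measure.map_id (μ := γ)]
  refine Measure.map_congr ?_
  filter_upwards [hγT] with p hp using Prod.ext rfl hp

-- Complementary slackness: a dual pair of potentials that is tight on one plan detects optimality.
theorem IsPlan.isW2Optimal_iff (hμ : MemLp id 2 μ) (hν : MemLp id 2 ν) (hφ : Integrable φ μ)
    (hψ : Integrable ψ ν) (hle : ∀ᵐ y ∂ν, ∀ x, φ x + ψ y ≤ ‖x - y‖ ^ 2) (hγ₀ : IsPlan μ ν γ₀)
    (heq : ∀ᵐ p ∂γ₀, φ p.1 + ψ p.2 = ‖p.1 - p.2‖ ^ 2) (hγ : IsPlan μ ν γ) :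
    IsW2Optimal μ ν γ ↔ ∀ᵐ p ∂γ, φ p.1 + ψ p.2 = ‖p.1 - p.2‖ ^ 2 := by
  have hcost {γ} (h : IsPlan μ ν γ) : Integrable (fun p => ‖p.1 - p.2‖ ^ 2) γ :=
    ((h.memLp_fst hμ).sub (h.memLp_snd hν)).integrable_norm_pow two_ne_zero
  have hle_ae {γ} (h : IsPlan μ ν γ) : ∀ᵐ p ∂γ, φ p.1 + ψ p.2 ≤ ‖p.1 - p.2‖ ^ 2 := by
    rw [← h.2] at hle
    filter_upwards [ae_of_ae_map (by fun_prop) hle] with p hp using hp p.1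
  have hdual {γ} (h : IsPlan μ ν γ) :
      ∫ x, φ x ∂μ + ∫ y, ψ y ∂ν ≤ ∫ p, ‖p.1 - p.2‖ ^ 2 ∂γ :=
    (h.integral_potentials hφ hψ).symm.trans_le
      (integral_mono_ae (h.integrable_potentials hφ hψ) (hcost h) (hle_ae h))
  have htight : ∫ x, φ x ∂μ + ∫ y, ψ y ∂ν = ∫ p, ‖p.1 - p.2‖ ^ 2 ∂γ₀ :=
    (hγ₀.integral_potentials hφ hψ).symm.trans (integral_congr_ae heq)
  have hW : W2sq μ ν = ENNReal.ofReal (∫ x, φ x ∂μ + ∫ y, ψ y ∂ν) := by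
    refine le_antisymm (iInf_le_of_le ⟨γ₀, hγ₀⟩ ?_) (le_iInf fun γ => ?_)
    · rw [cost_eq_ofReal_integral (hcost hγ₀), htight]
    · rw [cost_eq_ofReal_integral (hcost γ.2)]
      exact ENNReal.ofReal_le_ofReal (hdual γ.2)
  rw [IsW2Optimal, and_iff_right hγ, hW, cost_eq_ofReal_integral (hcost hγ),
    ENNReal.ofReal_eq_ofReal_iff (integral_nonneg fun _ => by positivity)
      (htight ▸ integral_nonneg fun _ => by positivity), eq_comm,
    ← hγ.integral_potentials hφ hψ]
  exact integral_eq_iff_of_ae_le (hγ.integrable_potentials hφ hψ) (hcost hγ) (hle_ae hγ)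

end Potentials

section AffineMap

theorem exists_comp_comp_eq_self {K V W : Type*} [DivisionRing K] [AddCommGroup V] [Module K V]
    [AddCommGroup W] [Module K W] (f : V →ₗ[K] W) : ∃ g : W →ₗ[K] V, f ∘ₗ g ∘ₗ f = f := by
  obtain ⟨r, hr⟩ := f.rangeRestrict.exists_rightInverse_of_surjective f.range_rangeRestrict
  obtain ⟨g, hg⟩ := r.exists_extend
  refine ⟨g, LinearMap.ext fun v => ?_⟩
  have hgr : g (f v) = r (f.rangeRestrict v) := LinearMap.congr_fun hg (f.rangeRestrict v)
  have hfr : f.rangeRestrict (r (f.rangeRestrict v)) = f.rangeRestrict v :=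
    LinearMap.congr_fun hr (f.rangeRestrict v)
  rw [LinearMap.comp_apply, LinearMap.comp_apply, hgr]
  exact congrArg Subtype.val hfr

theorem apply_eq_zero_of_inner_self_eq_zero {E : Type*} [NormedAddCommGroup E]
    [InnerProductSpace ℝ E] {A : E →L[ℝ] E} (hA : A.IsPositive) {x : E}
    (hx : inner ℝ (A x) x = 0) : A x = 0 := by
  let B : LinearMap.BilinForm ℝ E := innerₗ E ∘ₗ A
  have hB : LinearMap.IsSymm B := ⟨fun u v => by
    simpa [B, real_inner_comm] using hA.inner_left_eq_inner_right u v⟩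
  have hsq : inner ℝ (A x) (A x) ^ 2 ≤ inner ℝ (A x) x * inner ℝ (A (A x)) (A x) :=
    B.apply_sq_le_of_symm hA.inner_nonneg_left hB x (A x)
  rw [hx, zero_mul] at hsq
  exact inner_self_eq_zero.1 (pow_eq_zero_iff two_ne_zero |>.1 (hsq.antisymm (sq_nonneg _)))

variable {d : ℕ} {A : Rd d →L[ℝ] Rd d} {b : Rd d}

theorem norm_sub_sq_eq_of_isPositive (hA : A.IsPositive) {x y z : Rd d} (hz : A z = y - b) :
    ‖x - y‖ ^ 2 = (‖x‖ ^ 2 - 2 * inner ℝ x b - inner ℝ (A x) x) +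
      (‖y‖ ^ 2 - inner ℝ (y - b) z) + inner ℝ (A (x - z)) (x - z) := by
  have hsymm : inner ℝ (A z) x = inner ℝ (A x) z := by
    rw [hA.inner_left_eq_inner_right, real_inner_comm]
  have hAz : inner ℝ (A x) z = inner ℝ x y - inner ℝ x b := by
    rw [hA.inner_left_eq_inner_right, hz, inner_sub_right]
  rw [norm_sub_sq_real, ← hz]
  simp only [map_sub, inner_sub_left, inner_sub_right]
  linarith

theorem add_eq_norm_sub_sq_iff_of_isPositive (hA : A.IsPositive) {x y z : Rd d}
    (hz : A z = y - b) :
    (‖x‖ ^ 2 - 2 * inner ℝ x b - inner ℝ (A x) x) + (‖y‖ ^ 2 - inner ℝ (y - b) z) = ‖x - y‖ ^ 2 ↔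
      y = A x + b := by
  have hzero : y = A x + b ↔ A (x - z) = 0 := by
    rw [map_sub, hz, sub_eq_zero, eq_sub_iff_add_eq, eq_comm]
  rw [norm_sub_sq_eq_of_isPositive hA hz, left_eq_add, hzero]
  exact ⟨apply_eq_zero_of_inner_self_eq_zero hA, fun h => by rw [h, inner_zero_left]⟩

theorem memLp_id_map_apply_add {μ : Measure (Rd d)} [IsFiniteMeasure μ] (hμ : MemLp id 2 μ) :
    MemLp id 2 (μ.map fun x => A x + b) :=
  (memLp_map_measure_iff aestronglyMeasurable_id (by fun_prop)).2
    ((A.comp_memLp' hμ).add (memLp_const b))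

-- The potentials are Brenier's: `x ↦ ⟪A x, x⟫ / 2 + ⟪x, b⟫` and its Legendre transform, where a
-- generalized inverse of `A` stands for the inverse on the support of the second marginal.
theorem isW2Optimal_iff_ae_eq_of_isPositive {μ : Measure (Rd d)} [IsProbabilityMeasure μ]
    (hμ : MemLp id 2 μ) (hA : A.IsPositive) {γ : Measure (Rd d × Rd d)}
    (hγ : IsPlan μ (μ.map fun x => A x + b) γ) :
    IsW2Optimal μ (μ.map fun x => A x + b) γ ↔ ∀ᵐ p ∂γ, p.2 = A p.1 + b := by
  obtain ⟨G₀, hG₀⟩ := exists_comp_comp_eq_self (A : Rd d →ₗ[ℝ] Rd d)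
  let G := G₀.toContinuousLinearMap
  have hG (x : Rd d) : A (G (A x)) = A x := LinearMap.congr_fun hG₀ x
  let φ (x : Rd d) : ℝ := ‖x‖ ^ 2 - 2 * inner ℝ x b - inner ℝ (A x) x
  let ψ (y : Rd d) : ℝ := ‖y‖ ^ 2 - inner ℝ (y - b) (G (y - b))
  have : IsProbabilityMeasure (μ.map fun x => A x + b) :=
    Measure.isProbabilityMeasure_map (by fun_prop)
  have hν : MemLp id 2 (μ.map fun x => A x + b) := memLp_id_map_apply_add hμ
  have hφ : Integrable φ μ := ((hμ.integrable_norm_pow two_ne_zero).sub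
    (((hμ.inner_const b).integrable one_le_two).const_mul 2)).sub
      (integrable_inner_of_memLp_two (A.comp_memLp' hμ) hμ)
  have hsub : MemLp (fun y => y - b) 2 (μ.map fun x => A x + b) := hν.sub (memLp_const b)
  have hψ : Integrable ψ (μ.map fun x => A x + b) := (hν.integrable_norm_pow two_ne_zero).sub
    (integrable_inner_of_memLp_two hsub (G.comp_memLp' hsub))
  have hrange : ∀ᵐ y ∂μ.map fun x => A x + b, A (G (y - b)) = y - b :=
    (ae_map_iff (by fun_prop) (measurableSet_eq_fun (by fun_prop) (by fun_prop))).2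
      (ae_of_all _ fun x => by simp only [add_sub_cancel_right, hG])
  have hle : ∀ᵐ y ∂μ.map fun x => A x + b, ∀ x, φ x + ψ y ≤ ‖x - y‖ ^ 2 := by
    filter_upwards [hrange] with y hy x
    rw [norm_sub_sq_eq_of_isPositive hA hy]
    exact le_add_of_nonneg_right (hA.inner_nonneg_left _)
  have htight {γ} (h : IsPlan μ (μ.map fun x => A x + b) γ) :
      ∀ᵐ p ∂γ, φ p.1 + ψ p.2 = ‖p.1 - p.2‖ ^ 2 ↔ p.2 = A p.1 + b := by
    rw [← h.2] at hrange
    filter_upwards [ae_of_ae_map (by fun_prop) hrange] with p hp using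
      add_eq_norm_sub_sq_iff_of_isPositive hA hp
  have hplan := isPlan_map_prodMk (μ := μ) (T := fun x => A x + b) (by fun_prop)
  refine (IsPlan.isW2Optimal_iff hμ hν hφ hψ hle hplan ?_ hγ).trans
    (Filter.eventually_congr (htight hγ))
  exact (Filter.eventually_congr (htight hplan)).2 (ae_map_prodMk_snd_eq (by fun_prop))

theorem isW2Optimal_iff_eq_map_of_isPositive {μ : Measure (Rd d)} [IsProbabilityMeasure μ]
    (hμ : MemLp id 2 μ) (hA : A.IsPositive) {γ : Measure (Rd d × Rd d)} :
    IsW2Optimal μ (μ.map fun x => A x + b) γ ↔ γ = μ.map fun x => (x, A x + b) := by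
  constructor
  · exact fun h => h.1.eq_map_prodMk (by fun_prop)
      ((isW2Optimal_iff_ae_eq_of_isPositive hμ hA h.1).1 h)
  · rintro rfl
    exact (isW2Optimal_iff_ae_eq_of_isPositive hμ hA (isPlan_map_prodMk (by fun_prop))).2
      (ae_map_prodMk_snd_eq (by fun_prop))

end AffineMap

section GaussianMap

variable {ι : Type*} [Fintype ι] [DecidableEq ι]

theorem adjoint_toEuclideanCLM (A : Matrix ι ι ℝ) :
    (Matrix.toEuclideanCLM (𝕜 := ℝ) A).adjoint = Matrix.toEuclideanCLM (𝕜 := ℝ) A.transpose := by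
  rw [← ContinuousLinearMap.star_eq_adjoint, ← map_star, Matrix.star_eq_conjTranspose,
    Matrix.conjTranspose_eq_transpose_of_trivial]

theorem isPositive_toEuclideanCLM {A : Matrix ι ι ℝ} (hA : A.PosSemidef) :
    (Matrix.toEuclideanCLM (𝕜 := ℝ) A).IsPositive := by
  rw [← ContinuousLinearMap.isPositive_toLinearMap_iff, Matrix.coe_toEuclideanCLM_eq_toEuclideanLin]
  exact Matrix.isPositive_toEuclideanLin_iff.2 hA

theorem map_toEuclideanCLM_add_multivariateGaussian (m b : EuclideanSpace ℝ ι)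
    {S : Matrix ι ι ℝ} (hS : S.PosSemidef) (A : Matrix ι ι ℝ) :
    (multivariateGaussian m S).map (fun x => Matrix.toEuclideanCLM (𝕜 := ℝ) A x + b) =
      multivariateGaussian (Matrix.toEuclideanCLM (𝕜 := ℝ) A m + b) (A * S * A.transpose) := by
  set L := Matrix.toEuclideanCLM (𝕜 := ℝ) A
  have hAS : (A * S * A.transpose).PosSemidef := by
    simpa using hS.mul_mul_conjTranspose_same A
  have hmap : (multivariateGaussian m S).map (fun x => L x + b) =
      ((multivariateGaussian m S).map L).map fun x => b + x := by
    simp_rw [add_comm _ b]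
    rw [Measure.map_map (by fun_prop) (by fun_prop), Function.comp_def]
  rw [hmap]
  refine IsGaussian.ext ?_ ?_
  · rw [integral_map (by fun_prop) (by fun_prop), integral_map (by fun_prop) (by fun_prop)]
    simp only [id_eq, integral_id_multivariateGaussian]
    rw [integral_add (integrable_const _) (L.integrable_comp IsGaussian.integrable_fun_id),
      L.integral_comp_comm IsGaussian.integrable_fun_id, integral_id_multivariateGaussian]
    simp only [integral_const, probReal_univ, one_smul, add_comm]
  · ext u v
    rw [covarianceBilin_map_const_add, covarianceBilin_map IsGaussian.memLp_two_id,
      adjoint_toEuclideanCLM, covarianceBilin_multivariateGaussian hS,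
      covarianceBilin_multivariateGaussian hAS]
    simp only [Matrix.ofLp_toEuclideanCLM]
    rw [← Matrix.mulVec_mulVec, ← Matrix.mulVec_mulVec, Matrix.dotProduct_mulVec u.ofLp,
      ← Matrix.mulVec_transpose]

/-- The matrix of the optimal affine map between centred Gaussians with covariances `S₀`, `S₁`. -/
noncomputable def gaussianMapMatrix (S₀ S₁ : Matrix ι ι ℝ) : Matrix ι ι ℝ :=
  (CFC.sqrt S₀)⁻¹ * CFC.sqrt (CFC.sqrt S₀ * S₁ * CFC.sqrt S₀) * (CFC.sqrt S₀)⁻¹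

theorem posSemidef_gaussianMapMatrix (S₀ S₁ : Matrix ι ι ℝ) :
    (gaussianMapMatrix S₀ S₁).PosSemidef := by
  have hR : (CFC.sqrt S₀).PosSemidef := Matrix.nonneg_iff_posSemidef.1 (CFC.sqrt_nonneg _)
  have hQ : (CFC.sqrt (CFC.sqrt S₀ * S₁ * CFC.sqrt S₀)).PosSemidef :=
    Matrix.nonneg_iff_posSemidef.1 (CFC.sqrt_nonneg _)
  simpa only [hR.isHermitian.inv.eq, gaussianMapMatrix] using
    hQ.mul_mul_conjTranspose_same (CFC.sqrt S₀)⁻¹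

theorem gaussianMapMatrix_mul_mul_self {S₀ S₁ : Matrix ι ι ℝ} (hS₀ : S₀.PosSemidef)
    (hS₁ : S₁.PosSemidef) (hdet : S₀.det ≠ 0) :
    gaussianMapMatrix S₀ S₁ * S₀ * gaussianMapMatrix S₀ S₁ = S₁ := by
  have hR : CFC.sqrt S₀ * CFC.sqrt S₀ = S₀ := CFC.sqrt_mul_sqrt_self S₀ hS₀.nonneg
  have hRS₁R : (CFC.sqrt S₀ * S₁ * CFC.sqrt S₀).PosSemidef := by
    have hRh : (CFC.sqrt S₀).IsHermitian := (CFC.sqrt_nonneg S₀).isSelfAdjoint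
    simpa only [hRh.eq] using hS₁.mul_mul_conjTranspose_same (CFC.sqrt S₀)
  have hQ := CFC.sqrt_mul_sqrt_self _ hRS₁R.nonneg
  have hRdet : IsUnit (CFC.sqrt S₀).det := by
    rw [← hR, Matrix.det_mul] at hdet
    exact (left_ne_zero_of_mul hdet).isUnit
  unfold gaussianMapMatrix
  set R := CFC.sqrt S₀
  set Q := CFC.sqrt (R * S₁ * R)
  have hinv : R⁻¹ * R = 1 := Matrix.nonsing_inv_mul R hRdet
  have hinv' : R * R⁻¹ = 1 := Matrix.mul_nonsing_inv R hRdet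
  calc R⁻¹ * Q * R⁻¹ * S₀ * (R⁻¹ * Q * R⁻¹)
      = R⁻¹ * Q * (R⁻¹ * R) * (R * R⁻¹) * Q * R⁻¹ := by rw [← hR]; simp only [mul_assoc]
    _ = R⁻¹ * (Q * Q) * R⁻¹ := by rw [hinv, hinv']; simp only [mul_one, mul_assoc]
    _ = (R⁻¹ * R) * S₁ * (R * R⁻¹) := by rw [hQ]; simp only [mul_assoc]
    _ = S₁ := by rw [hinv, hinv', one_mul, mul_one]

theorem isW2Optimal_multivariateGaussian_iff {d : ℕ} (m₀ m₁ : Rd d)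
    {S₀ S₁ : Matrix (Fin d) (Fin d) ℝ} (hS₀ : S₀.PosSemidef) (hS₁ : S₁.PosSemidef)
    (hdet : S₀.det ≠ 0) {γ : Measure (Rd d × Rd d)} :
    IsW2Optimal (multivariateGaussian m₀ S₀) (multivariateGaussian m₁ S₁) γ ↔
      γ = (multivariateGaussian m₀ S₀).map fun x => (x, gaussianMap m₀ S₀ m₁ S₁ x) := by
  let A := gaussianMapMatrix S₀ S₁
  let L := Matrix.toEuclideanCLM (𝕜 := ℝ) A
  have hA : A.PosSemidef := posSemidef_gaussianMapMatrix S₀ S₁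
  have hT : gaussianMap m₀ S₀ m₁ S₁ = fun x => L x + (m₁ - L m₀) := by
    funext x
    simp only [gaussianMap, L, A, gaussianMapMatrix, map_sub]
    abel
  have hmap : (multivariateGaussian m₀ S₀).map (fun x => L x + (m₁ - L m₀)) =
      multivariateGaussian m₁ S₁ := by
    have hAt : A.transpose = A := by simpa using hA.isHermitian.eq
    rw [map_toEuclideanCLM_add_multivariateGaussian m₀ _ hS₀, hAt,
      gaussianMapMatrix_mul_mul_self hS₀ hS₁ hdet, add_sub_cancel]
  rw [hT, ← hmap]
  exact isW2Optimal_iff_eq_map_of_isPositive IsGaussian.memLp_two_id (isPositive_toEuclideanCLM hA)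

end GaussianMap

section LinearProgramming

variable {ι V : Type*} [AddCommGroup V] [Module ℝ V]

theorem exists_ne_zero_apply_eq_zero_of_finrank_range_lt_card [Finite ι] (A : (ι → ℝ) →ₗ[ℝ] V)
    {s : Finset ι} (hs : Module.finrank ℝ A.range < s.card) :
    ∃ h : ι → ℝ, h ≠ 0 ∧ A h = 0 ∧ ∀ i ∉ s, h i = 0 := by
  let e : (s → ℝ) →ₗ[ℝ] ι → ℝ := Function.ExtendByZero.linearMap ℝ Subtype.val
  have hker : LinearMap.ker (A.rangeRestrict ∘ₗ e) ≠ ⊥ :=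
    LinearMap.ker_ne_bot_of_finrank_lt (by simpa using hs)
  obtain ⟨h, hAh, hne⟩ := (Submodule.ne_bot_iff _).1 hker
  refine ⟨e h, fun h0 => hne ?_, congrArg Subtype.val hAh, fun i hi => ?_⟩
  · exact Function.extend_injective Subtype.val_injective (0 : ι → ℝ)
      (h0.trans (Function.extend_zero Subtype.val).symm)
  · exact Function.extend_apply' _ _ _ fun ⟨j, hj⟩ => hi (hj ▸ j.2)

-- Ratio test: move along `h` until the first coordinate of `w` vanishes.
theorem exists_nonneg_add_smul_support_ssubset [Finite ι] {w h : ι → ℝ} (hw : 0 ≤ w)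
    (hsupp : h.support ⊆ w.support) (hneg : ∃ i, h i < 0) :
    ∃ t : ℝ, 0 ≤ t ∧ 0 ≤ w + t • h ∧ (w + t • h).support ⊂ w.support := by
  have := Fintype.ofFinite ι
  obtain ⟨i, hi, hmin⟩ := ({i | h i < 0} : Finset ι).exists_min_image (fun i => w i / -h i)
    (hneg.imp fun i hi => by simpa using hi)
  simp only [Finset.mem_filter, Finset.mem_univ, true_and] at hi hmin
  refine ⟨w i / -h i, div_nonneg (hw i) (neg_nonneg.2 hi.le), fun j => ?_,
    (Set.ssubset_iff_of_subset ?_).2 ⟨i, hsupp hi.ne, ?_⟩⟩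
  · obtain hj | hj := le_or_gt 0 (h j)
    · exact add_nonneg (hw j) (mul_nonneg (div_nonneg (hw i) (neg_nonneg.2 hi.le)) hj)
    · have hratio := hmin j hj
      rw [le_div_iff₀ (neg_pos.2 hj)] at hratio
      simpa using add_le_add_left hratio (w i / -h i * h j)
  · exact (Function.support_add _ _).trans
      (Set.union_subset subset_rfl ((Function.support_const_smul_subset _ _).trans hsupp))
  · simp [div_neg, div_mul_cancel₀ _ hi.ne]

variable [Fintype ι] {A : (ι → ℝ) →ₗ[ℝ] V} (hA : ∀ h, A h = 0 → ∑ i, h i = 0)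

include hA

theorem exists_nonneg_apply_eq_support_ssubset (c : (ι → ℝ) →ₗ[ℝ] ℝ) {w : ι → ℝ} (hw : 0 ≤ w)
    (hcard : Module.finrank ℝ A.range < w.support.ncard) :
    ∃ w', 0 ≤ w' ∧ A w' = A w ∧ c w' ≤ c w ∧ w'.support ⊂ w.support := by
  classical
  rw [Set.ncard_eq_toFinset_card'] at hcard
  obtain ⟨h, hne, hAh, hch, hsupp⟩ :
      ∃ h : ι → ℝ, h ≠ 0 ∧ A h = 0 ∧ c h ≤ 0 ∧ h.support ⊆ w.support := by
    obtain ⟨h, hne, hAh, hzero⟩ := exists_ne_zero_apply_eq_zero_of_finrank_range_lt_card A hcard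
    have hsupp : h.support ⊆ w.support := fun i hi => by
      simpa using mt (hzero i) hi
    obtain hc | hc := le_total (c h) 0
    · exact ⟨h, hne, hAh, hc, hsupp⟩
    · exact ⟨-h, neg_ne_zero.2 hne, by rw [map_neg, hAh, neg_zero], by rwa [map_neg, neg_nonpos],
        by rwa [Function.support_neg]⟩
  have hneg : ∃ i, h i < 0 := by
    by_contra! hnonneg
    exact hne ((Fintype.sum_eq_zero_iff_of_nonneg hnonneg).1 (hA h hAh))
  obtain ⟨t, ht, hnonneg, hlt⟩ := exists_nonneg_add_smul_support_ssubset hw hsupp hneg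
  refine ⟨w + t • h, hnonneg, ?_, ?_, hlt⟩
  · rw [map_add, map_smul, hAh, smul_zero, add_zero]
  · rw [map_add, map_smul]
    exact add_le_of_nonpos_right (mul_nonpos_of_nonneg_of_nonpos ht hch)

theorem isCompact_setOf_nonneg_apply_eq (b : V) : IsCompact {w : ι → ℝ | 0 ≤ w ∧ A w = b} := by
  obtain hempty | ⟨w₀, -, rfl⟩ := {w : ι → ℝ | 0 ≤ w ∧ A w = b}.eq_empty_or_nonempty
  · simp only [hempty, isCompact_empty]
  · have hfiber (w : ι → ℝ) : A w = A w₀ ↔ w - w₀ ∈ A.ker := by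
      rw [LinearMap.mem_ker, map_sub, sub_eq_zero]
    have hclosed : IsClosed {w : ι → ℝ | 0 ≤ w ∧ A w = A w₀} := by
      simp only [hfiber]
      exact isClosed_Ici.inter
        (A.ker.closed_of_finiteDimensional.preimage (continuous_id.sub continuous_const))
    refine (isCompact_Icc (a := 0) (b := fun _ => ∑ i, w₀ i)).of_isClosed_subset hclosed ?_
    rintro w ⟨hw, hAw⟩
    have hsum : ∑ i, w i = ∑ i, w₀ i := by
      simpa [sub_eq_zero] using hA _ ((hfiber w).1 hAw)
    exact ⟨hw, fun i => hsum ▸ Finset.single_le_sum (fun j _ => hw j) (Finset.mem_univ i)⟩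

theorem exists_isMinOn_ncard_support_le_finrank_range (c : (ι → ℝ) →ₗ[ℝ] ℝ) {b : V}
    (hne : {w : ι → ℝ | 0 ≤ w ∧ A w = b}.Nonempty) :
    ∃ w ∈ {w : ι → ℝ | 0 ≤ w ∧ A w = b}, IsMinOn c {w | 0 ≤ w ∧ A w = b} w ∧
      w.support.ncard ≤ Module.finrank ℝ A.range := by
  obtain ⟨w₀, hw₀⟩ := (isCompact_setOf_nonneg_apply_eq hA b).exists_isMinOn hne
    c.continuous_of_finiteDimensional.continuousOn
  obtain ⟨w, ⟨hw, hmin⟩, hsmall⟩ := exists_minimalFor_of_wellFoundedLT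
    (fun w => w ∈ {w : ι → ℝ | 0 ≤ w ∧ A w = b} ∧ IsMinOn c {w | 0 ≤ w ∧ A w = b} w)
    (fun w => w.support.ncard) ⟨w₀, hw₀⟩
  refine ⟨w, hw, hmin, ?_⟩
  by_contra! hcard
  obtain ⟨w', hw', hAw', hle, hlt⟩ := exists_nonneg_apply_eq_support_ssubset hA c hw.1 hcard
  have hcard_lt := Set.ncard_lt_ncard hlt
  exact hcard_lt.not_ge (hsmall ⟨⟨hw', hAw'.trans hw.2⟩, fun v hv => hle.trans (hmin hv)⟩
    hcard_lt.le)

end LinearProgramming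

section DiscreteTransport

/-- The row and column sums of a matrix, indexed by pairs, as one linear map: the equality
constraints of the discrete transport problem. -/
def marginals (ι κ : Type*) [Fintype ι] [Fintype κ] :
    (ι × κ → ℝ) →ₗ[ℝ] (ι → ℝ) × (κ → ℝ) :=
  (LinearMap.pi fun i => ∑ j, LinearMap.proj (i, j)).prod
    (LinearMap.pi fun j => ∑ i, LinearMap.proj (i, j))

variable {ι κ : Type*} [Fintype ι] [Fintype κ]

theorem marginals_apply (w : ι × κ → ℝ) :
    marginals ι κ w = (fun i => ∑ j, w (i, j), fun j => ∑ i, w (i, j)) := by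
  ext <;> simp [marginals]

theorem sum_eq_zero_of_marginals_eq_zero {h : ι × κ → ℝ} (hh : marginals ι κ h = 0) :
    ∑ p, h p = 0 := by
  rw [marginals_apply, Prod.mk_eq_zero] at hh
  rw [Fintype.sum_prod_type]
  exact Finset.sum_eq_zero fun i _ => congrFun hh.1 i

-- The row sums and the column sums have the same total, so `marginals` is not surjective.
theorem finrank_range_marginals_lt [Nonempty ι] :
    Module.finrank ℝ (marginals ι κ).range < Fintype.card ι + Fintype.card κ := by
  have hne : (marginals ι κ).range ≠ ⊤ := by
    intro htop
    obtain ⟨w, hw⟩ := LinearMap.range_eq_top.1 htop (fun _ => 1, 0)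
    rw [marginals_apply, Prod.mk.injEq] at hw
    have htotal : ∑ _ : ι, (1 : ℝ) = ∑ _ : κ, 0 := by
      calc ∑ _ : ι, (1 : ℝ) = ∑ i, ∑ j, w (i, j) :=
            Finset.sum_congr rfl fun i _ => (congrFun hw.1 i).symm
        _ = ∑ j, ∑ i, w (i, j) := Finset.sum_comm
        _ = ∑ _ : κ, 0 := Finset.sum_congr rfl fun j _ => congrFun hw.2 j
    simp at htotal
  simpa using Submodule.finrank_lt hne

theorem exists_isWeightPlan_forall_le_and_supportCard_le {K₀ K₁ : ℕ} {π₀ : Fin K₀ → ℝ≥0}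
    {π₁ : Fin K₁ → ℝ≥0} (hπ : ∑ k, π₀ k = ∑ l, π₁ l) (hπ₀ : ∑ k, π₀ k ≠ 0)
    (c : Fin K₀ → Fin K₁ → ℝ≥0) :
    ∃ w, IsWeightPlan π₀ π₁ w ∧ (∀ w', IsWeightPlan π₀ π₁ w' →
      ∑ k, ∑ l, w k l * c k l ≤ ∑ k, ∑ l, w' k l * c k l) ∧ supportCard w ≤ K₀ + K₁ - 1 := by
  let toReal (w : Fin K₀ → Fin K₁ → ℝ≥0) (p : Fin K₀ × Fin K₁) : ℝ := w p.1 p.2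
  let b : (Fin K₀ → ℝ) × (Fin K₁ → ℝ) := (fun k => π₀ k, fun l => π₁ l)
  let C : (Fin K₀ × Fin K₁ → ℝ) →ₗ[ℝ] ℝ := ∑ p, (c p.1 p.2 : ℝ) • LinearMap.proj p
  have hC (w) : C (toReal w) = (∑ k, ∑ l, w k l * c k l : ℝ≥0) := by
    simp [C, toReal, Fintype.sum_prod_type, mul_comm]
  have hplan (w) : IsWeightPlan π₀ π₁ w ↔ 0 ≤ toReal w ∧ marginals _ _ (toReal w) = b := by
    have hnonneg : 0 ≤ toReal w := fun p => (w p.1 p.2).coe_nonneg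
    simp only [hnonneg, true_and, IsWeightPlan, marginals_apply, b, toReal, Prod.mk.injEq,
      funext_iff, ← NNReal.coe_sum, NNReal.coe_inj]
  obtain ⟨w₀, hw₀⟩ := exists_coupling hπ
  obtain ⟨v, hv, hmin, hcard⟩ := exists_isMinOn_ncard_support_le_finrank_range
    (fun _ => sum_eq_zero_of_marginals_eq_zero) C ⟨toReal w₀, (hplan w₀).1 hw₀⟩
  have : Nonempty (Fin K₀) := (Finset.nonempty_of_sum_ne_zero hπ₀).to_type
  have hrank : Module.finrank ℝ (marginals (Fin K₀) (Fin K₁)).range < K₀ + K₁ := by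
    simpa using finrank_range_marginals_lt (ι := Fin K₀) (κ := Fin K₁)
  obtain ⟨w, rfl⟩ : ∃ w, toReal w = v :=
    ⟨fun k l => ⟨v (k, l), hv.1 (k, l)⟩, rfl⟩
  refine ⟨w, (hplan w).2 hv, fun w' hw' => ?_, ?_⟩
  · rw [← NNReal.coe_le_coe, ← hC, ← hC]
    exact hmin ((hplan w').1 hw')
  · have hsupport : supportCard w = (toReal w).support.ncard := by
      simp only [supportCard, toReal, Function.support, ne_eq, NNReal.coe_eq_zero]
    omega

end DiscreteTransport

section MixturePlans

variable {d K₀ K₁ : ℕ} {π₀ : Fin K₀ → ℝ≥0} {π₁ : Fin K₁ → ℝ≥0}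
  {ν₀ : Fin K₀ → Measure (Rd d)} {ν₁ : Fin K₁ → Measure (Rd d)} {w : Fin K₀ → Fin K₁ → ℝ≥0}
  {Γ : Fin K₀ → Fin K₁ → Measure (Rd d × Rd d)}

theorem map_sum_sum_smul {α β : Type*} [MeasurableSpace α] [MeasurableSpace β]
    (w : Fin K₀ → Fin K₁ → ℝ≥0) (ρ : Fin K₀ → Fin K₁ → Measure α) {f : α → β}
    (hf : Measurable f) :
    (∑ k, ∑ l, w k l • ρ k l).map f = ∑ k, ∑ l, w k l • (ρ k l).map f := by
  simp only [← Fintype.sum_prod_type' (f := fun k l => w k l • ρ k l),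
    ← Fintype.sum_prod_type' (f := fun k l => w k l • (ρ k l).map f)]
  exact map_sum_smul _ _ _ hf

theorem cost_sum_sum_smul : cost (∑ k, ∑ l, w k l • Γ k l) =
    ∑ k, ∑ l, (w k l : ℝ≥0∞) * cost (Γ k l) := by
  simp only [cost, lintegral_finsetSum_measure, lintegral_smul_measure]
  rfl

theorem IsWeightPlan.isPlan_sum_sum_smul (hw : IsWeightPlan π₀ π₁ w)
    (hΓ : ∀ k l, IsPlan (ν₀ k) (ν₁ l) (Γ k l)) :
    IsPlan (∑ k, π₀ k • ν₀ k) (∑ l, π₁ l • ν₁ l) (∑ k, ∑ l, w k l • Γ k l) := by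
  constructor
  · simp_rw [map_sum_sum_smul _ _ measurable_fst, (hΓ _ _).1, ← Finset.sum_smul, hw.1]
  · rw [map_sum_sum_smul _ _ measurable_snd, Finset.sum_comm]
    simp_rw [(hΓ _ _).2, ← Finset.sum_smul, hw.2]

theorem IsWeightPlan.isGMM_sum_sum_smul {E : Type*} [TopologicalSpace E] [AddCommMonoid E]
    [Module ℝ E] [MeasurableSpace E] (hw : IsWeightPlan π₀ π₁ w) (hπ₀ : ∑ k, π₀ k = 1)
    {ρ : Fin K₀ → Fin K₁ → Measure E} (hρ : ∀ k l, IsGaussian (ρ k l)) :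
    IsGMM (supportCard w) (∑ k, ∑ l, w k l • ρ k l) := by
  rw [← Fintype.sum_prod_type' (f := fun k l => w k l • ρ k l)]
  refine isGMM_ncard_support_sum ?_ fun p => hρ p.1 p.2
  simp only [Fintype.sum_prod_type, hw.1, hπ₀]

theorem mul_W2sq_le_mul_cost (hΓ : ∀ k l, w k l ≠ 0 → IsPlan (ν₀ k) (ν₁ l) (Γ k l))
    (k : Fin K₀) (l : Fin K₁) :
    (w k l : ℝ≥0∞) * W2sq (ν₀ k) (ν₁ l) ≤ w k l * cost (Γ k l) := by
  by_cases h : w k l = 0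
  · simp only [h, ENNReal.coe_zero, zero_mul, le_refl]
  · gcongr
    exact iInf_le_of_le ⟨Γ k l, hΓ k l h⟩ le_rfl

theorem discreteCost_le_cost_sum_sum_smul
    (hΓ : ∀ k l, w k l ≠ 0 → IsPlan (ν₀ k) (ν₁ l) (Γ k l)) :
    discreteCost ν₀ ν₁ w ≤ cost (∑ k, ∑ l, w k l • Γ k l) := by
  rw [cost_sum_sum_smul]
  exact Finset.sum_le_sum fun k _ => Finset.sum_le_sum fun l _ => mul_W2sq_le_mul_cost hΓ k l

theorem MW2sq_le_discreteCost (hν₀ : ∀ k, IsGaussian (ν₀ k)) (hν₁ : ∀ l, IsGaussian (ν₁ l))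
    (hπ₀ : ∑ k, π₀ k = 1) (hw : IsWeightPlan π₀ π₁ w) :
    MW2sq (∑ k, π₀ k • ν₀ k) (∑ l, π₁ l • ν₁ l) ≤ discreteCost ν₀ ν₁ w := by
  choose g hgG hg using fun k l => exists_isGaussian_isW2Optimal (ν₀ k) (ν₁ l)
  refine iInf_le_of_le ⟨∑ k, ∑ l, w k l • g k l, hw.isPlan_sum_sum_smul fun k l => (hg k l).1, _,
    hw.isGMM_sum_sum_smul hπ₀ hgG⟩ ?_
  simp only [cost_sum_sum_smul, (hg _ _).2, discreteCost, le_refl]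

theorem eq_of_le_of_sum_le_sum {ι : Type*} {s : Finset ι} {f g : ι → ℝ≥0∞}
    (hle : ∀ i ∈ s, f i ≤ g i) (hf : ∑ i ∈ s, f i ≠ ∞) (hsum : ∑ i ∈ s, g i ≤ ∑ i ∈ s, f i)
    {i : ι} (hi : i ∈ s) : f i = g i := by
  classical
  refine le_antisymm (hle i hi) ?_
  rw [← Finset.add_sum_erase _ _ hi] at hf
  rw [← Finset.add_sum_erase _ g hi, ← Finset.add_sum_erase _ f hi] at hsum
  refine (ENNReal.add_le_add_iff_right (ENNReal.add_ne_top.1 hf).2).1 (hsum.trans' ?_)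
  gcongr with j hj
  exact hle j (Finset.mem_of_mem_erase hj)

theorem exists_isOptimalWeight_supportCard_le (hν₀ : ∀ k, IsGaussian (ν₀ k))
    (hν₁ : ∀ l, IsGaussian (ν₁ l)) (hπ : ∑ k, π₀ k = ∑ l, π₁ l)
    (hπ₀ : ∑ k, π₀ k ≠ 0) :
    ∃ w, IsOptimalWeight π₀ π₁ ν₀ ν₁ w ∧ supportCard w ≤ K₀ + K₁ - 1 := by
  obtain ⟨w, hw, hmin, hcard⟩ := exists_isWeightPlan_forall_le_and_supportCard_le hπ hπ₀
    fun k l => (W2sq (ν₀ k) (ν₁ l)).toNNReal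
  have hcost (w : Fin K₀ → Fin K₁ → ℝ≥0) : discreteCost ν₀ ν₁ w =
      (∑ k, ∑ l, w k l * (W2sq (ν₀ k) (ν₁ l)).toNNReal : ℝ≥0) := by
    push_cast
    simp only [ENNReal.coe_toNNReal (W2sq_ne_top _ _), discreteCost]
  refine ⟨w, ⟨hw, fun w' hw' => ?_⟩, hcard⟩
  rw [hcost, hcost]
  exact_mod_cast hmin w' hw'

end MixturePlans

section MixtureTransport

variable {d K₀ K₁ : ℕ} {π₀ : Fin K₀ → ℝ≥0} {π₁ : Fin K₁ → ℝ≥0}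
  {ν₀ : Fin K₀ → Measure (Rd d)} {ν₁ : Fin K₁ → Measure (Rd d)} {w : Fin K₀ → Fin K₁ → ℝ≥0}
  (hν₀ : ∀ k, IsGaussian (ν₀ k)) (hν₁ : ∀ l, IsGaussian (ν₁ l)) (hπ₀ : ∑ k, π₀ k = 1)

include hν₀ hν₁ hπ₀

theorem IsOptimalWeight.isMW2Optimal_sum_sum_smul (hw : IsOptimalWeight π₀ π₁ ν₀ ν₁ w)
    {g : Fin K₀ → Fin K₁ → Measure (Rd d × Rd d)} (hgG : ∀ k l, IsGaussian (g k l))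
    (hg : ∀ k l, IsW2Optimal (ν₀ k) (ν₁ l) (g k l)) :
    IsMW2Optimal (∑ k, π₀ k • ν₀ k) (∑ l, π₁ l • ν₁ l) (∑ k, ∑ l, w k l • g k l) := by
  refine ⟨hw.1.isPlan_sum_sum_smul fun k l => (hg k l).1,
    ⟨_, hw.1.isGMM_sum_sum_smul hπ₀ hgG⟩, ?_⟩
  have hcost : cost (∑ k, ∑ l, w k l • g k l) = discreteCost ν₀ ν₁ w := by
    simp only [cost_sum_sum_smul, (hg _ _).2, discreteCost]
  rw [hcost]
  refine le_antisymm (le_iInf fun γ => ?_) (MW2sq_le_discreteCost hν₀ hν₁ hπ₀ hw.1)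
  obtain ⟨w', hw', Γ, hΓ, hγ⟩ := exists_plan_decomposition hν₀ hν₁ γ.2.1 γ.2.2
  rw [hγ]
  exact (hw.2 w' hw').trans (discreteCost_le_cost_sum_sum_smul hΓ)

theorem IsMW2Optimal.exists_eq_sum_sum_smul {γ : Measure (Rd d × Rd d)}
    (hγ : IsMW2Optimal (∑ k, π₀ k • ν₀ k) (∑ l, π₁ l • ν₁ l) γ) :
    ∃ w, IsOptimalWeight π₀ π₁ ν₀ ν₁ w ∧ ∃ Γ : Fin K₀ → Fin K₁ → Measure (Rd d × Rd d),
      (∀ k l, IsW2Optimal (ν₀ k) (ν₁ l) (Γ k l)) ∧ γ = ∑ k, ∑ l, w k l • Γ k l := by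
  classical
  choose g _ hg using fun k l => exists_isGaussian_isW2Optimal (ν₀ k) (ν₁ l)
  obtain ⟨w, hw, Γ, hΓ, rfl⟩ := exists_plan_decomposition hν₀ hν₁ hγ.1 hγ.2.1
  have hle {w'} (hw' : IsWeightPlan π₀ π₁ w') :
      cost (∑ k, ∑ l, w k l • Γ k l) ≤ discreteCost ν₀ ν₁ w' :=
    hγ.2.2 ▸ MW2sq_le_discreteCost hν₀ hν₁ hπ₀ hw'
  have hterm (k l) : (w k l : ℝ≥0∞) * W2sq (ν₀ k) (ν₁ l) = w k l * cost (Γ k l) := by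
    refine eq_of_le_of_sum_le_sum (s := Finset.univ)
      (f := fun p : Fin K₀ × Fin K₁ => (w p.1 p.2 : ℝ≥0∞) * W2sq (ν₀ p.1) (ν₁ p.2))
      (g := fun p => w p.1 p.2 * cost (Γ p.1 p.2)) (fun p _ => mul_W2sq_le_mul_cost hΓ p.1 p.2)
      ?_ ?_ (Finset.mem_univ (k, l))
    · exact ENNReal.sum_ne_top.2 fun p _ =>
        ENNReal.mul_ne_top ENNReal.coe_ne_top (W2sq_ne_top (ν₀ p.1) (ν₁ p.2))
    · rw [Fintype.sum_prod_type, Fintype.sum_prod_type]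
      exact cost_sum_sum_smul.symm.trans_le (hle hw)
  refine ⟨w, ⟨hw, fun w' hw' => (discreteCost_le_cost_sum_sum_smul hΓ).trans (hle hw')⟩,
    fun k l => if w k l = 0 then g k l else Γ k l, fun k l => ?_, ?_⟩
  · dsimp only
    split_ifs with h
    · exact hg k l
    · exact ⟨hΓ k l h, ((ENNReal.mul_right_inj (ENNReal.coe_ne_zero.2 h)
        ENNReal.coe_ne_top).1 (hterm k l)).symm⟩
  · refine Finset.sum_congr rfl fun k _ => Finset.sum_congr rfl fun l _ => ?_
    dsimp only
    split_ifs with h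
    · rw [h, zero_smul, zero_smul]
    · rfl

end MixtureTransport

section Interpolation

/-- The interpolation map `P t` as a continuous linear map, so that images of Gaussian measures
under it are Gaussian. -/
noncomputable def interpolationCLM (d : ℕ) (t : ℝ) : Rd d × Rd d →L[ℝ] Rd d :=
  (1 - t) • ContinuousLinearMap.fst ℝ (Rd d) (Rd d) + t • ContinuousLinearMap.snd ℝ (Rd d) (Rd d)

variable {d K₀ K₁ : ℕ} {γ : Measure (Rd d × Rd d)} {t : ℝ}

theorem measurable_P : Measurable (P t : Rd d × Rd d → Rd d) :=
  (interpolationCLM d t).measurable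

theorem isGaussian_map_P [IsGaussian γ] : IsGaussian (γ.map (P t)) :=
  isGaussian_map (interpolationCLM d t)

theorem IsGMM.map_P {N : ℕ} (hγ : IsGMM N γ) : IsGMM N (γ.map (P t)) :=
  hγ.map (interpolationCLM d t)

theorem IsW2Optimal.isDisplacementInterpolation_map_P {μ ν : Measure (Rd d)}
    (h : IsW2Optimal μ ν γ) : IsDisplacementInterpolation μ ν fun t => γ.map (P t) :=
  ⟨γ, h, fun _ _ => rfl⟩

theorem IsDisplacementInterpolation.eq_map_gaussianMap {m₀ m₁ : Rd d}
    {S₀ S₁ : Matrix (Fin d) (Fin d) ℝ} {ρ : ℝ → Measure (Rd d)}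
    (h : IsDisplacementInterpolation (multivariateGaussian m₀ S₀) (multivariateGaussian m₁ S₁) ρ)
    (hS₀ : S₀.PosSemidef) (hS₁ : S₁.PosSemidef) (hdet : S₀.det ≠ 0) (ht : t ∈ Icc (0 : ℝ) 1) :
    ρ t = (multivariateGaussian m₀ S₀).map fun x =>
      (1 - t) • x + t • gaussianMap m₀ S₀ m₁ S₁ x := by
  obtain ⟨γ, hγ, hρ⟩ := h
  have hmeas : Measurable (gaussianMap m₀ S₀ m₁ S₁) := by
    unfold gaussianMap
    fun_prop
  rw [hρ t ht, (isW2Optimal_multivariateGaussian_iff m₀ m₁ hS₀ hS₁ hdet).1 hγ,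
    Measure.map_map measurable_P (by fun_prop)]
  rfl

variable {π₀ : Fin K₀ → ℝ≥0} {π₁ : Fin K₁ → ℝ≥0}
  {ν₀ : Fin K₀ → Measure (Rd d)} {ν₁ : Fin K₁ → Measure (Rd d)} {w : Fin K₀ → Fin K₁ → ℝ≥0}
  (hν₀ : ∀ k, IsGaussian (ν₀ k)) (hν₁ : ∀ l, IsGaussian (ν₁ l)) (hπ₀ : ∑ k, π₀ k = 1)

include hν₀ hν₁ hπ₀

theorem IsMW2Optimal.exists_map_P_eq_sum_sum_smul
    (hγ : IsMW2Optimal (∑ k, π₀ k • ν₀ k) (∑ l, π₁ l • ν₁ l) γ) :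
    ∃ w, IsOptimalWeight π₀ π₁ ν₀ ν₁ w ∧ ∃ ρ : Fin K₀ → Fin K₁ → ℝ → Measure (Rd d),
      (∀ k l, IsDisplacementInterpolation (ν₀ k) (ν₁ l) (ρ k l)) ∧
        ∀ t, γ.map (P t) = ∑ k, ∑ l, w k l • ρ k l t := by
  obtain ⟨w, hw, Γ, hΓ, rfl⟩ := hγ.exists_eq_sum_sum_smul hν₀ hν₁ hπ₀
  exact ⟨w, hw, _, fun k l => (hΓ k l).isDisplacementInterpolation_map_P,
    fun _ => map_sum_sum_smul _ _ measurable_P⟩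

theorem IsOptimalWeight.exists_isMW2Optimal_map_P_eq_sum_sum_smul
    (hw : IsOptimalWeight π₀ π₁ ν₀ ν₁ w) :
    ∃ γ, IsMW2Optimal (∑ k, π₀ k • ν₀ k) (∑ l, π₁ l • ν₁ l) γ ∧ IsGMM (supportCard w) γ ∧
      ∃ ρ : Fin K₀ → Fin K₁ → ℝ → Measure (Rd d),
        (∀ k l, IsDisplacementInterpolation (ν₀ k) (ν₁ l) (ρ k l) ∧
          ∀ t, IsGaussian (ρ k l t)) ∧
        ∀ t, γ.map (P t) = ∑ k, ∑ l, w k l • ρ k l t := by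
  choose g hgG hg using fun k l => exists_isGaussian_isW2Optimal (ν₀ k) (ν₁ l)
  exact ⟨_, hw.isMW2Optimal_sum_sum_smul hν₀ hν₁ hπ₀ hgG hg,
    hw.1.isGMM_sum_sum_smul hπ₀ hgG, _,
    fun k l => ⟨(hg k l).isDisplacementInterpolation_map_P, fun _ => isGaussian_map_P⟩,
    fun _ => map_sum_sum_smul _ _ measurable_P⟩

end Interpolation

end GMMTransport

theorem mainTheorem7 {d K₀ K₁ : ℕ}
    (π₀ : Fin K₀ → ℝ≥0) (hπ₀ : ∑ k, π₀ k = 1)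
    (m₀ : Fin K₀ → Rd d) (S₀ : Fin K₀ → Matrix (Fin d) (Fin d) ℝ)
    (hS₀ : ∀ k, (S₀ k).PosSemidef)
    (π₁ : Fin K₁ → ℝ≥0) (hπ₁ : ∑ l, π₁ l = 1)
    (m₁ : Fin K₁ → Rd d) (S₁ : Fin K₁ → Matrix (Fin d) (Fin d) ℝ)
    (hS₁ : ∀ l, (S₁ l).PosSemidef)
    (ν₀ : Fin K₀ → Measure (Rd d)) (hν₀ : ∀ k, ν₀ k = multivariateGaussian (m₀ k) (S₀ k))
    (ν₁ : Fin K₁ → Measure (Rd d)) (hν₁ : ∀ l, ν₁ l = multivariateGaussian (m₁ l) (S₁ l))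
    (μ₀ : Measure (Rd d)) (hμ₀ : μ₀ = ∑ k, π₀ k • ν₀ k)
    (μ₁ : Measure (Rd d)) (hμ₁ : μ₁ = ∑ l, π₁ l • ν₁ l) :
    -- every optimal plan interpolates through Gaussian mixtures of the stated form
    (∀ γ, IsMW2Optimal μ₀ μ₁ γ →
      (∀ t ∈ Icc (0 : ℝ) 1, IsFiniteGMM (γ.map (P t))) ∧
      ∃ w, IsOptimalWeight π₀ π₁ ν₀ ν₁ w ∧
        ∃ ρ : Fin K₀ → Fin K₁ → ℝ → Measure (Rd d),
          (∀ k l, IsDisplacementInterpolation (ν₀ k) (ν₁ l) (ρ k l)) ∧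
          ∀ t ∈ Icc (0 : ℝ) 1, γ.map (P t) = ∑ k, ∑ l, w k l • ρ k l t) ∧
    -- every optimal weight matrix arises, with Gaussian interpolations between the components
    (∀ w, IsOptimalWeight π₀ π₁ ν₀ ν₁ w →
      ∃ γ, IsMW2Optimal μ₀ μ₁ γ ∧
        ∃ ρ : Fin K₀ → Fin K₁ → ℝ → Measure (Rd d),
          (∀ k l, IsDisplacementInterpolation (ν₀ k) (ν₁ l) (ρ k l) ∧
            ∀ t ∈ Icc (0 : ℝ) 1, IsGaussian (ρ k l t)) ∧
          ∀ t ∈ Icc (0 : ℝ) 1, γ.map (P t) = ∑ k, ∑ l, w k l • ρ k l t) ∧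
    -- the explicit form of the interpolation between components when `S₀ k` is nonsingular
    (∀ k l, (S₀ k).det ≠ 0 →
      IsW2Optimal (ν₀ k) (ν₁ l)
        ((ν₀ k).map fun x => (x, gaussianMap (m₀ k) (S₀ k) (m₁ l) (S₁ l) x)) ∧
      ∀ ρ, IsDisplacementInterpolation (ν₀ k) (ν₁ l) ρ → ∀ t ∈ Icc (0 : ℝ) 1,
        ρ t = (ν₀ k).map fun x =>
          (1 - t) • x + t • gaussianMap (m₀ k) (S₀ k) (m₁ l) (S₁ l) x) ∧
    -- the optimal plan can be chosen so that there are at most `K₀ + K₁ - 1` components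
    (∃ w, IsOptimalWeight π₀ π₁ ν₀ ν₁ w ∧ supportCard w ≤ K₀ + K₁ - 1 ∧
      ∃ γ, IsMW2Optimal μ₀ μ₁ γ ∧ IsGMM (K₀ + K₁ - 1) γ ∧
        ∃ ρ : Fin K₀ → Fin K₁ → ℝ → Measure (Rd d),
          (∀ k l, IsDisplacementInterpolation (ν₀ k) (ν₁ l) (ρ k l) ∧
            ∀ t ∈ Icc (0 : ℝ) 1, IsGaussian (ρ k l t)) ∧
          ∀ t ∈ Icc (0 : ℝ) 1,
            γ.map (P t) = ∑ k, ∑ l, w k l • ρ k l t ∧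
            IsGMM (K₀ + K₁ - 1) (γ.map (P t))) := by
  have hG₀ (k) : IsGaussian (ν₀ k) := hν₀ k ▸ isGaussian_multivariateGaussian
  have hG₁ (l) : IsGaussian (ν₁ l) := hν₁ l ▸ isGaussian_multivariateGaussian
  subst hμ₀ hμ₁
  refine ⟨fun γ hγ => ⟨fun t _ => ?_, ?_⟩, fun w hw => ?_, fun k l hdet => ?_, ?_⟩
  · exact hγ.2.1.imp fun _ => IsGMM.map_P
  · obtain ⟨w, hw, ρ, hρ, hγρ⟩ := hγ.exists_map_P_eq_sum_sum_smul hG₀ hG₁ hπ₀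
    exact ⟨w, hw, ρ, hρ, fun t _ => hγρ t⟩
  · obtain ⟨γ, hγ, -, ρ, hρ, hγρ⟩ :=
      hw.exists_isMW2Optimal_map_P_eq_sum_sum_smul hG₀ hG₁ hπ₀
    exact ⟨γ, hγ, ρ, fun k l => (hρ k l).imp_right fun h t _ => h t, fun t _ => hγρ t⟩
  · rw [hν₀, hν₁]
    exact ⟨(isW2Optimal_multivariateGaussian_iff _ _ (hS₀ k) (hS₁ l) hdet).2 rfl,
      fun ρ hρ t => hρ.eq_map_gaussianMap (hS₀ k) (hS₁ l) hdet⟩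
  · obtain ⟨w, hw, hcard⟩ := exists_isOptimalWeight_supportCard_le hG₀ hG₁ (hπ₀.trans hπ₁.symm)
      (hπ₀ ▸ one_ne_zero)
    obtain ⟨γ, hγ, hγw, ρ, hρ, hγρ⟩ :=
      hw.exists_isMW2Optimal_map_P_eq_sum_sum_smul hG₀ hG₁ hπ₀
    have hγG := hγw.mono hcard
    exact ⟨w, hw, hcard, γ, hγ, hγG, ρ, fun k l => (hρ k l).imp_right fun h t _ => h t,
      fun t _ => ⟨hγρ t, hγG.map_P⟩⟩
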